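/- Let $N$ be a smooth manifold of dimension at least $3$ with a contact form $\alpha$, that is, a smooth nowhere vanishing $1$-form whose differential $d\alpha$ is nondegenerate on $\xi=\ker\alpha$. Let $X_R$ be its Reeb vector field, defined by $\iota_{X_R}d\alpha=0$ and $\alpha(X_R)=1$, and suppose that $X_R$ has a closed (periodic) orbit. Let $M=\mathbb{R}\times N$ be the symplectization of $(N,\alpha)$, with the symplectic form $\omega=d(e^{s}\alpha)$, where $s$ is the coordinate on $\mathbb{R}$. For a smooth function $f$ on $M$ let $X_f$ be the vector field with $df=\iota_{X_f}\omega$. Let $Ham$ be the set of all smooth paths $H=(H_t)_{t\in[0,1]}$ of smooth functions on $M$ (with no condition on supports) for which the flow $\phi_H^t$ of the time-dependent vector field $X_{H_t}$ exists as a family of diffeomorphisms of $M$ for all $t\in[0,1]$, endowed with the compact-open topology (uniform convergence of functions on compact subsets of $[0,1]\times M$). Let $\phi_H=\phi_H^1$ and let $\mathcal{H}(M)=\{\phi_H : H\in Ham\}$ be the group of Hamiltonian diffeomorphisms of $M$. Then there is no distance $d$ on $\mathcal{H}(M)$ such that $d(\phi,\psi)=d(\phi\chi,\psi\chi)=d(\chi\phi,\chi\psi)$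 for all $\phi,\psi,\chi\in\mathcal{H}(M)$ (a bi-invariant metric), and such that the map $Ham\times Ham\to\mathbb{R}$, $(H,K)\mapsto d(\phi_H,\phi_K)$, is continuous (the metric is $C^{-1}$). -/

import Mathlib

open scoped Manifold ContDiff Topology

noncomputable section

section Forms

variable {E : Type*} [NormedAddCommGroup E] [NormedSpace ℝ E] {H : Type*} [TopologicalSpace H]
  (I : ModelWithCorners ℝ E H) {M : Type*} [TopologicalSpace M] [ChartedSpace H M]

/-- Smoothness of a differential 1-form `α` on `M`, as a section of the cotangent bundle. -/
def IsSmoothOneForm [IsManifold I ∞ M] (α : Π x : M, TangentSpace I x →L[ℝ] ℝ) : Prop :=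
  ContMDiff I (I.prod 𝓘(ℝ, E →L[ℝ] ℝ)) ∞
    (fun x ↦ Bundle.TotalSpace.mk' (E →L[ℝ] ℝ)
      (E := fun y : M ↦ (TangentSpace I y →L[ℝ] Bundle.Trivial M ℝ y)) x (α x))

/-- The coordinate expression of the 1-form `α` in the preferred chart at `x₀`: its pullback by the
inverse of the chart, a 1-form on (the target of the chart in) the model vector space `E`. -/
def oneFormInChart (α : Π x : M, TangentSpace I x →L[ℝ] ℝ) (x₀ : M) (y : E) : E →L[ℝ] ℝ :=
  (α ((extChartAt I x₀).symm y)).comp (mfderiv 𝓘(ℝ, E) I (extChartAt I x₀).symm y)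

/-- The exterior derivative `dα` of a 1-form on a manifold without boundary. At `x` it is computed
in the preferred chart at `x` by `dα (u, v) = D_u α (v) - D_v α (u)`; Mathlib identifies the
tangent space at `x` with the model space `E` through this same chart. -/
def oneFormExtDeriv (α : Π x : M, TangentSpace I x →L[ℝ] ℝ) (x : M)
    (u v : TangentSpace I x) : ℝ :=
  (fderiv ℝ (oneFormInChart I α x) (extChartAt I x x) u : E →L[ℝ] ℝ) v -
    (fderiv ℝ (oneFormInChart I α x) (extChartAt I x x) v : E →L[ℝ] ℝ) u

end Forms

section Contact

variable {E : Type*} [NormedAddCommGroup E] [NormedSpace ℝ E] {H : Type*} [TopologicalSpace H]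
  (I : ModelWithCorners ℝ E H) {N : Type*} [TopologicalSpace N] [ChartedSpace H N]

/-- `α` is a contact form on `N`: a smooth nowhere vanishing 1-form (so that `ξ = ker α` is a smooth
hyperplane field) whose exterior derivative is nondegenerate on `ξ`. -/
structure IsContactForm [IsManifold I ∞ N] (α : Π x : N, TangentSpace I x →L[ℝ] ℝ) : Prop where
  smooth : IsSmoothOneForm I α
  ne_zero : ∀ x, α x ≠ 0
  nondegenerate : ∀ (x : N) (u : TangentSpace I x), α x u = 0 →
    (∀ v : TangentSpace I x, α x v = 0 → oneFormExtDeriv I α x u v = 0) → u = 0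

/-- `R` is the Reeb vector field of `α`: `ι_R dα = 0` and `α R = 1`. -/
def IsReebField (α : Π x : N, TangentSpace I x →L[ℝ] ℝ) (R : Π x : N, TangentSpace I x) : Prop :=
  ∀ x : N, (∀ v : TangentSpace I x, oneFormExtDeriv I α x (R x) v = 0) ∧ α x (R x) = 1

/-- `α` admits a closed characteristic, i.e. its Reeb vector field has a periodic orbit. -/
def HasClosedCharacteristic (α : Π x : N, TangentSpace I x →L[ℝ] ℝ) : Prop :=
  ∃ R : Π x : N, TangentSpace I x, IsReebField I α R ∧
    ∃ (γ : ℝ → N) (T : ℝ), 0 < T ∧ Function.Periodic γ T ∧ IsMIntegralCurve (I := I) γ R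

/-- The primitive `e^s α` on `ℝ × N`, where `s` is the `ℝ`-coordinate and `α` is pulled back to
`ℝ × N` by the projection to `N`. -/
def symplectizationPrimitive (α : Π x : N, TangentSpace I x →L[ℝ] ℝ) (p : ℝ × N) :
    TangentSpace (𝓘(ℝ, ℝ).prod I) p →L[ℝ] ℝ :=
  Real.exp p.1 • (α p.2).comp (mfderiv (𝓘(ℝ, ℝ).prod I) I Prod.snd p)

/-- The symplectic form `d(e^s α)` of the symplectization `ℝ × N`. -/
def symplectizationForm (α : Π x : N, TangentSpace I x →L[ℝ] ℝ) (p : ℝ × N)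
    (u v : TangentSpace (𝓘(ℝ, ℝ).prod I) p) : ℝ :=
  oneFormExtDeriv (𝓘(ℝ, ℝ).prod I) (symplectizationPrimitive I α) p u v

end Contact

section Hamiltonian

variable {E : Type*} [NormedAddCommGroup E] [NormedSpace ℝ E] {H : Type*} [TopologicalSpace H]
  (I : ModelWithCorners ℝ E H) {M : Type*} [TopologicalSpace M] [ChartedSpace H M]

/-- The value at time `t ∈ [0,1]` of a path of functions on `M` (constant in `t` outside of
`[0,1]`, where it is never used). -/
def atTime (h : C(unitInterval × M, ℝ)) (t : ℝ) (x : M) : ℝ :=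
  h (Set.projIcc 0 1 zero_le_one t, x)

/-- The path `t ↦ h_t`, `t ∈ [0,1]`, of functions on `M` is smooth (jointly in `t` and `x`). -/
def IsSmoothPath (h : C(unitInterval × M, ℝ)) : Prop :=
  ContMDiffOn (𝓘(ℝ, ℝ).prod I) 𝓘(ℝ, ℝ) ∞ (fun p : ℝ × M ↦ atTime h p.1 p.2)
    (Set.Icc (0 : ℝ) 1 ×ˢ Set.univ)

/-- `v` is the symplectic gradient of `f` at `x`: `df = ι_v Ω` on the tangent space at `x`. -/
def IsSymplecticGradientAt (Ω : Π x : M, TangentSpace I x → TangentSpace I x → ℝ)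
    (f : M → ℝ) (x : M) (v : TangentSpace I x) : Prop :=
  ∀ w : TangentSpace I x, mfderiv I 𝓘(ℝ, ℝ) f x w = Ω x v w

/-- `φ` (restricted to times in `[0,1]`) is the Hamiltonian flow of the path of Hamiltonian
functions `h`: a family of diffeomorphisms of `M` starting at the identity, such that each
trajectory `t ↦ φ_t x` has at time `t` the symplectic gradient of `h_t` as its velocity. -/
structure IsHamiltonianFlow (Ω : Π x : M, TangentSpace I x → TangentSpace I x → ℝ)
    (h : C(unitInterval × M, ℝ)) (φ : ℝ → (M ≃ₘ⟮I, I⟯ M)) : Prop where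
  map_zero : φ 0 = Diffeomorph.refl I M ∞
  hasDeriv : ∀ t ∈ Set.Icc (0 : ℝ) 1, ∀ x : M, ∃ v : TangentSpace I (φ t x),
    IsSymplecticGradientAt I Ω (atTime h t) (φ t x) v ∧
    HasMFDerivWithinAt 𝓘(ℝ, ℝ) I (fun τ ↦ φ τ x) (Set.Icc (0 : ℝ) 1) t
      ((1 : ℝ →L[ℝ] ℝ).smulRight v)

/-- The smooth path of Hamiltonian functions `h` has a flow on `[0,1]`, with time-one map `ψ`;
that is, `ψ = φ_h`. -/
def Generates (Ω : Π x : M, TangentSpace I x → TangentSpace I x → ℝ)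
    (h : C(unitInterval × M, ℝ)) (ψ : M ≃ₘ⟮I, I⟯ M) : Prop :=
  IsSmoothPath I h ∧ ∃ φ : ℝ → (M ≃ₘ⟮I, I⟯ M), IsHamiltonianFlow I Ω h φ ∧ φ 1 = ψ

/-- The set of smooth paths of Hamiltonian functions that have a flow on `[0,1]`. -/
def Ham (Ω : Π x : M, TangentSpace I x → TangentSpace I x → ℝ) : Set C(unitInterval × M, ℝ) :=
  {h | ∃ ψ : M ≃ₘ⟮I, I⟯ M, Generates I Ω h ψ}

/-- The set of Hamiltonian diffeomorphisms of `M` (it is a group under composition). -/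
def HamDiffeo (Ω : Π x : M, TangentSpace I x → TangentSpace I x → ℝ) : Set (M ≃ₘ⟮I, I⟯ M) :=
  {ψ | ∃ h : C(unitInterval × M, ℝ), Generates I Ω h ψ}

/-- `d` restricts to a bi-invariant metric on the group `G` of diffeomorphisms of `M`; the values of
`d` at other diffeomorphisms are irrelevant. Here `χ.trans φ` is the composition `φ ∘ χ`. -/
structure IsBiinvariantMetric (G : Set (M ≃ₘ⟮I, I⟯ M))
    (d : (M ≃ₘ⟮I, I⟯ M) → (M ≃ₘ⟮I, I⟯ M) → ℝ) : Prop where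
  eq_zero_iff : ∀ φ ∈ G, ∀ ψ ∈ G, d φ ψ = 0 ↔ φ = ψ
  symm : ∀ φ ∈ G, ∀ ψ ∈ G, d φ ψ = d ψ φ
  triangle : ∀ φ ∈ G, ∀ ψ ∈ G, ∀ χ ∈ G, d φ χ ≤ d φ ψ + d ψ χ
  right_invariant : ∀ φ ∈ G, ∀ ψ ∈ G, ∀ χ ∈ G, d (χ.trans φ) (χ.trans ψ) = d φ ψ
  left_invariant : ∀ φ ∈ G, ∀ ψ ∈ G, ∀ χ ∈ G, d (φ.trans χ) (ψ.trans χ) = d φ ψ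

/-- The distance `d` on Hamiltonian diffeomorphisms is `C^{-1}`: the composition
`D : (h, k) ↦ d (φ_h, φ_k)` is continuous on `Ham × Ham` for the compact-open topology (which is
the topology of the space `C(unitInterval × M, ℝ)` of continuous maps). -/
def IsCMinusOne (Ω : Π x : M, TangentSpace I x → TangentSpace I x → ℝ)
    (d : (M ≃ₘ⟮I, I⟯ M) → (M ≃ₘ⟮I, I⟯ M) → ℝ) : Prop :=
  ∃ D : C(unitInterval × M, ℝ) × C(unitInterval × M, ℝ) → ℝ,
    (∀ (h k : C(unitInterval × M, ℝ)) (φ ψ : M ≃ₘ⟮I, I⟯ M),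
      Generates I Ω h φ → Generates I Ω k ψ → D (h, k) = d φ ψ) ∧
    ContinuousOn D (Ham I Ω ×ˢ Ham I Ω)

end Hamiltonian

end

/-!
A bi-invariant metric `d` that is continuous in the Hamiltonians is contradicted by conjugation
towards `s = +∞`, where Hamiltonians homogeneous in `e^s` become small on compact sets.

Let `χ` be a Hamiltonian diffeomorphism that maps `ℝ × P` to itself, for a neighbourhood `P` of
some point of `N`, and increases `s` there by at least `c > 0`; let `φ_H` be the time-one map of
an autonomous Hamiltonian `H = e^s g` with `g` supported in `P`. Then `χⁿ φ_H χ⁻ⁿ` is generated by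
`H ∘ χ⁻ⁿ`, and `|H ∘ χ⁻ⁿ| ≤ C e^{s - nc}` (`exp_decay_comp_symm`), which tends to `0` uniformly on
compact sets (`tendsto_zero_of_exp_decay`). Continuity gives `d (χⁿ φ_H χ⁻ⁿ, id) → 0`, while
bi-invariance makes this sequence constant. Hence `φ_H = id`, which fails as soon as `φ_H` moves a
point.

Both `χ` and `φ_H` are obtained from a contact Hamiltonian near one point `x₀`
(`IsContactAt.exists_pushing_hamiltonian`). In a chart, with `A` the coordinate expression of `α`
and `ξ = x - x₀`, the function `A₀ ξ + ½ (D_ξ A) ξ` has a contact vector field that vanishes at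
`x₀` and has linearization `-½` on the contact hyperplane and `-1` on the Reeb direction
(`IsContactAt.linearization`), while the `s`-component of the Hamiltonian vector field of its
product with `e^s` is `1` at `x₀`. So `x₀` is a sink of the projected flow, whose small ellipsoidal
neighbourhoods are mapped into themselves, and the lifted flow pushes these to `s = +∞`. Cutting
off in the chart makes the flow compactly supported over `N`.

The flows are produced on the model space, where they are smooth in the initial condition by the
inverse function theorem on the Banach space of continuous paths (`exists_smooth_flow`); they
preserve the primitive `e^s A` exactly (`exists_hamiltonianFlow`), so that they conjugate
Hamiltonian flows to Hamiltonian flows (`IsLocalHamiltonianFlow.conj`), and they extend by the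
identity to the symplectization (`IsLocalHamiltonianFlow.generates`).
-/

open scoped NNReal
open Set Filter

/-! ### Smooth dependence of flows on the initial condition -/

section Perturbation

variable {B : Type*} [NormedAddCommGroup B] [NormedSpace ℝ B] [CompleteSpace B]

/-- A smooth map at Lipschitz distance less than `1` from the identity is a diffeomorphism. -/
theorem exists_homeomorph_id_add {Θ : B → B} {c : ℝ≥0} (hΘ : ContDiff ℝ ∞ Θ) (hc : c < 1)
    (hL : LipschitzWith c Θ) :
    ∃ S : B ≃ₜ B, (∀ x, S x = x + Θ x) ∧ ContDiff ℝ ∞ S ∧ ContDiff ℝ ∞ S.symm := by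
  rcases subsingleton_or_nontrivial B with hB | hB
  · exact ⟨Homeomorph.refl B, fun x ↦ Subsingleton.elim _ _, contDiff_id, contDiff_id⟩
  have happ : ApproximatesLinearOn (fun x ↦ x + Θ x)
      ((ContinuousLinearEquiv.refl ℝ B : B ≃L[ℝ] B) : B →L[ℝ] B) univ c := by
    intro x _ y _
    have := hL.norm_sub_le x y
    simpa [add_sub_add_comm] using this
  have hc' : Subsingleton B ∨
      c < ‖((ContinuousLinearEquiv.refl ℝ B).symm : B →L[ℝ] B)‖₊⁻¹ := by
    right
    simpa using hc
  let S := happ.toHomeomorph _ hc'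
  have hS : ∀ x, S x = x + Θ x := fun x ↦ rfl
  have hSm : ContDiff ℝ ∞ S := contDiff_id.add hΘ
  have hder : ∀ x, ‖-fderiv ℝ Θ x‖ < 1 := fun x ↦ by
    rw [norm_neg]
    exact (norm_fderiv_le_of_lipschitz ℝ hL).trans_lt (by exact_mod_cast hc)
  refine ⟨S, hS, hSm, ?_⟩
  refine S.contDiff_symm
    (f₀' := fun x ↦ ContinuousLinearEquiv.unitsEquiv ℝ B (Units.oneSub _ (hder x))) ?_ hSm
  intro x
  have h1 : HasFDerivAt S (ContinuousLinearMap.id ℝ B + fderiv ℝ Θ x) x :=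
    (hasFDerivAt_id x).add ((hΘ.differentiable (by simp)) x).hasFDerivAt
  convert h1 using 1
  ext v
  simp [Units.oneSub]

end Perturbation

section Superposition

universe u

variable {K : Type*} [TopologicalSpace K] [CompactSpace K]

/-- Pointwise application `(f, u) ↦ (t ↦ f t (u t))`, as a continuous bilinear map on spaces of
continuous functions. -/
noncomputable def pointwiseApply (K : Type*) [TopologicalSpace K] [CompactSpace K] (E F : Type*)
    [NormedAddCommGroup E] [NormedSpace ℝ E] [NormedAddCommGroup F] [NormedSpace ℝ F] :
    C(K, E →L[ℝ] F) →L[ℝ] C(K, E) →L[ℝ] C(K, F) :=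
  LinearMap.mkContinuous₂
    (LinearMap.mk₂ ℝ (fun (f : C(K, E →L[ℝ] F)) (u : C(K, E)) ↦
        (⟨fun t ↦ f t (u t), f.continuous.clm_apply u.continuous⟩ : C(K, F)))
      (fun f g u ↦ by ext; simp) (fun a f u ↦ by ext; simp)
      (fun f u v ↦ by ext; simp) (fun a f u ↦ by ext; simp))
    1 (fun f u ↦ by
      rw [one_mul, ContinuousMap.norm_le _ (by positivity)]
      exact fun t ↦ (f t).le_of_opNorm_le_of_le (f.norm_coe_le_norm t) (u.norm_coe_le_norm t))

@[simp]
theorem pointwiseApply_apply {E F : Type*}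
    [NormedAddCommGroup E] [NormedSpace ℝ E] [NormedAddCommGroup F] [NormedSpace ℝ F]
    (f : C(K, E →L[ℝ] F)) (u : C(K, E)) (t : K) : pointwiseApply K E F f u t = f t (u t) := rfl

theorem contDiff_pointwiseApply {E F : Type*} [NormedAddCommGroup E] [NormedSpace ℝ E]
    [NormedAddCommGroup F] [NormedSpace ℝ F] {n : WithTop ℕ∞} :
    ContDiff ℝ n (pointwiseApply K E F) := by
  refine IsBoundedLinearMap.contDiff ⟨⟨fun f g ↦ map_add _ f g, fun a f ↦ map_smul _ a f⟩,
    1, one_pos, fun f ↦ ?_⟩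
  refine ContinuousLinearMap.opNorm_le_bound _ (by positivity) fun u ↦ ?_
  rw [one_mul, ContinuousMap.norm_le _ (by positivity)]
  exact fun t ↦ (f t).le_of_opNorm_le_of_le (f.norm_coe_le_norm t) (u.norm_coe_le_norm t)

theorem hasFDerivAt_comp_continuousMap {E F : Type*}
    [NormedAddCommGroup E] [NormedSpace ℝ E] [NormedAddCommGroup F] [NormedSpace ℝ F]
    (X : C(E, F)) (X' : C(E, E →L[ℝ] F)) (hX : ∀ x, HasFDerivAt X (X' x) x) (u : C(K, E)) :
    HasFDerivAt (fun u : C(K, E) ↦ X.comp u) (pointwiseApply K E F (X'.comp u)) u := by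
  rw [hasFDerivAt_iff_isLittleO_nhds_zero, Asymptotics.isLittleO_iff]
  intro ε hε
  have hcont : Continuous (fun w : C(K, E) ↦ X'.comp w) := X'.continuous_postcomp
  obtain ⟨δ, hδ, hball⟩ := (Metric.continuousAt_iff (α := C(K, E))
    (β := C(K, E →L[ℝ] F))).1 hcont.continuousAt ε hε
  filter_upwards [Metric.ball_mem_nhds (0 : C(K, E)) hδ] with v hv
  rw [mem_ball_zero_iff] at hv
  rw [ContinuousMap.norm_le _ (by positivity)]
  intro t
  have hseg : ∀ z ∈ segment ℝ (u t) (u t + v t), ‖X' z - X' (u t)‖ ≤ ε := by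
    intro z hz
    rw [segment_eq_image'] at hz
    obtain ⟨s, hs, rfl⟩ := hz
    have hlt : dist (u + s • v) u < δ := by
      rw [dist_eq_norm, add_sub_cancel_left, norm_smul, Real.norm_of_nonneg hs.1]
      exact (mul_le_of_le_one_left (norm_nonneg _) hs.2).trans_lt hv
    have h1 := (hball hlt).le
    have h2 := ContinuousMap.dist_apply_le_dist (f := X'.comp (u + s • v)) (g := X'.comp u) t
    have h3 := h2.trans h1
    rw [dist_eq_norm] at h3
    simpa using h3
  have key := (convex_segment (u t) (u t + v t)).norm_image_sub_le_of_norm_hasFDerivWithin_le'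
    (f := X) (f' := X') (φ := X' (u t)) (fun z _ ↦ (hX z).hasFDerivWithinAt) hseg
    (left_mem_segment ℝ _ _) (right_mem_segment ℝ _ _)
  calc _ = ‖X (u t + v t) - X (u t) - (X' (u t)) (u t + v t - u t)‖ := by simp
    _ ≤ ε * ‖u t + v t - u t‖ := key
    _ ≤ ε * ‖v‖ := by
      rw [add_sub_cancel_left]
      gcongr
      exact v.norm_coe_le_norm t

/-- The superposition operator `u ↦ X ∘ u` on continuous functions is as smooth as `X`: its
derivative is pointwise application of the superposition operator of the derivative of `X`. -/
theorem contDiff_nat_comp_continuousMap {E : Type u} [NormedAddCommGroup E] [NormedSpace ℝ E]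
    (n : ℕ) : ∀ {F : Type u} [NormedAddCommGroup F] [NormedSpace ℝ F] (X : C(E, F)),
      ContDiff ℝ n X → ContDiff ℝ n (fun u : C(K, E) ↦ X.comp u) := by
  induction n with
  | zero =>
    intro F _ _ X _
    exact contDiff_zero.2 X.continuous_postcomp
  | succ n ih =>
    intro F _ _ X hX
    have h1 := contDiff_succ_iff_fderiv (n := (n : WithTop ℕ∞)).1 (by exact_mod_cast hX)
    let X' : C(E, E →L[ℝ] F) := ⟨fderiv ℝ X, h1.2.2.continuous⟩
    have h2 := ih X' h1.2.2
    push_cast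
    rw [contDiff_succ_iff_hasFDerivAt]
    have hL : ContDiff ℝ n (pointwiseApply K E F) := contDiff_pointwiseApply
    exact ⟨fun u ↦ pointwiseApply K E F (X'.comp u), hL.comp h2,
      fun u ↦ hasFDerivAt_comp_continuousMap X X' (fun x ↦ (h1.1 x).hasFDerivAt) u⟩

theorem contDiff_comp_continuousMap {E F : Type u} [NormedAddCommGroup E] [NormedSpace ℝ E]
    [NormedAddCommGroup F] [NormedSpace ℝ F] (X : C(E, F)) (hX : ContDiff ℝ ∞ X) :
    ContDiff ℝ ∞ (fun u : C(K, E) ↦ X.comp u) :=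
  contDiff_infty.2 fun n ↦ contDiff_nat_comp_continuousMap n X (contDiff_infty.1 hX n)

end Superposition

section Flow

theorem continuous_extend_path {E : Type*} [TopologicalSpace E] (u : C(unitInterval, E)) :
    Continuous fun τ : ℝ ↦ u (projIcc 0 1 zero_le_one τ) :=
  u.continuous.comp continuous_projIcc

variable {E : Type*} [NormedAddCommGroup E] [NormedSpace ℝ E] [CompleteSpace E]

theorem hasDerivAt_integral_path (u : C(unitInterval, E)) (t : ℝ) :
    HasDerivAt (fun t ↦ ∫ τ in (0 : ℝ)..t, u (projIcc 0 1 zero_le_one τ))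
      (u (projIcc 0 1 zero_le_one t)) t :=
  (continuous_extend_path u).integral_hasStrictDerivAt 0 t |>.hasDerivAt

/-- Integration `u ↦ (t ↦ ∫₀ᵗ u)` on continuous paths parametrized by `[0,1]`. -/
noncomputable def pathIntegral (E : Type*) [NormedAddCommGroup E] [NormedSpace ℝ E]
    [CompleteSpace E] :
    C(unitInterval, E) →L[ℝ] C(unitInterval, E) :=
  LinearMap.mkContinuous
    { toFun := fun u ↦ ⟨fun t ↦ ∫ τ in (0 : ℝ)..t, u (projIcc 0 1 zero_le_one τ),
        (continuous_iff_continuousAt.2 fun t ↦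
          (hasDerivAt_integral_path u t).continuousAt).comp continuous_subtype_val⟩
      map_add' := fun u v ↦ by
        ext t
        exact intervalIntegral.integral_add
          ((continuous_extend_path u).intervalIntegrable _ _)
          ((continuous_extend_path v).intervalIntegrable _ _)
      map_smul' := fun a u ↦ by
        ext t
        exact intervalIntegral.integral_smul a _ } 1 (fun u ↦ by
      rw [one_mul, ContinuousMap.norm_le _ (norm_nonneg _)]
      intro t
      refine (intervalIntegral.norm_integral_le_of_norm_le_const
        (C := ‖u‖) fun τ _ ↦ u.norm_coe_le_norm _).trans ?_
      rw [sub_zero, abs_of_nonneg t.2.1]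
      exact mul_le_of_le_one_right (norm_nonneg _) t.2.2)

theorem pathIntegral_apply (u : C(unitInterval, E)) (t : unitInterval) :
    pathIntegral E u t = ∫ τ in (0 : ℝ)..t, u (projIcc 0 1 zero_le_one τ) := rfl

theorem norm_pathIntegral_le (u : C(unitInterval, E)) : ‖pathIntegral E u‖ ≤ ‖u‖ := by
  have h : ‖pathIntegral E‖ ≤ 1 := LinearMap.mkContinuous_norm_le _ zero_le_one _
  simpa using (pathIntegral E).le_of_opNorm_le h u

/-- A path that solves the integral equation `w t = x + ∫₀ᵗ u` has derivative `u`. -/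
theorem hasDerivWithinAt_of_eq_pathIntegral {w u : C(unitInterval, E)} {x : E}
    (h : ∀ t, w t = x + pathIntegral E u t) {t : ℝ} (ht : t ∈ Icc (0 : ℝ) 1) :
    HasDerivWithinAt (fun τ ↦ w (projIcc 0 1 zero_le_one τ))
      (u (projIcc 0 1 zero_le_one t)) (Icc 0 1) t := by
  refine ((hasDerivAt_integral_path u t).const_add x).hasDerivWithinAt.congr ?_ ?_
  · intro τ hτ
    rw [h, pathIntegral_apply, projIcc_of_mem zero_le_one hτ]
  · rw [h, pathIntegral_apply, projIcc_of_mem zero_le_one ht]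

/-- The flow, for times in `[0,1]`, of a smooth vector field with small Lipschitz constant. It is
smooth in the initial condition, and its derivative solves the variational equation. The solution
paths are `(id - Θ)⁻¹` of the constant paths, where `Θ u = ∫₀ᵗ X ∘ u` is smooth and contracting on
the Banach space of continuous paths. -/
theorem exists_smooth_flow (X : E → E) (hX : ContDiff ℝ ∞ X) (hL : LipschitzWith (1 / 4) X) :
    ∃ φ : ℝ → E ≃ₜ E, (∀ x, φ 0 x = x) ∧ (∀ t, ContDiff ℝ ∞ (φ t)) ∧
      (∀ t, ContDiff ℝ ∞ (φ t).symm) ∧ (∀ x, X x = 0 → ∀ t, φ t x = x) ∧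
      (∀ t ∈ Icc (0 : ℝ) 1, ∀ x,
        HasDerivWithinAt (fun τ ↦ φ τ x) (X (φ t x)) (Icc 0 1) t) ∧
      (∀ t ∈ Icc (0 : ℝ) 1, ∀ x v,
        HasDerivWithinAt (fun τ ↦ fderiv ℝ (φ τ) x v)
          (fderiv ℝ X (φ t x) (fderiv ℝ (φ t) x v)) (Icc 0 1) t) := by
  let Xc : C(E, E) := ⟨X, hX.continuous⟩
  let X' : C(E, E →L[ℝ] E) := ⟨fderiv ℝ X, hX.continuous_fderiv (by simp)⟩
  have hX' : ∀ x, HasFDerivAt Xc (X' x) x := fun x ↦ (hX.differentiable (by simp) x).hasFDerivAt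
  let Nm : C(unitInterval, E) → C(unitInterval, E) := fun u ↦ Xc.comp u
  have hNm : ContDiff ℝ ∞ Nm := contDiff_comp_continuousMap Xc hX
  have hNlip : ∀ u v, ‖Nm u - Nm v‖ ≤ 1 / 4 * ‖u - v‖ := by
    intro u v
    rw [ContinuousMap.norm_le _ (by positivity)]
    intro t
    have h1 := hL.norm_sub_le (u t) (v t)
    have h2 := (u - v).norm_coe_le_norm t
    simp only [ContinuousMap.sub_apply] at h2 ⊢
    refine h1.trans ?_
    push_cast
    gcongr
  have hΘ : ContDiff ℝ ∞ fun u ↦ -(pathIntegral E (Nm u)) :=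
    ((pathIntegral E).contDiff.comp hNm).neg
  have hΘL : LipschitzWith (1 / 4) fun u ↦ -(pathIntegral E (Nm u)) := by
    refine LipschitzWith.of_dist_le_mul fun u v ↦ ?_
    rw [dist_eq_norm, dist_eq_norm, neg_sub_neg, ← map_sub, norm_sub_rev u v]
    exact (norm_pathIntegral_le _).trans (by simpa using hNlip v u)
  obtain ⟨S, hS, -, hSsymm⟩ := exists_homeomorph_id_add hΘ (by
    rw [← NNReal.coe_lt_coe]; norm_num) hΘL
  let cst : E →L[ℝ] C(unitInterval, E) := ContinuousLinearMap.const ℝ unitInterval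
  have hcst : ∀ x t, cst x t = x := fun x t ↦ rfl
  let path : E → C(unitInterval, E) := fun x ↦ S.symm (cst x)
  have hpath : ContDiff ℝ ∞ path := hSsymm.comp cst.contDiff
  have heq : ∀ x, path x = cst x + pathIntegral E (Nm (path x)) := by
    intro x
    have h1 : S (path x) = cst x := S.apply_symm_apply _
    rw [hS] at h1
    rw [← h1]
    abel
  let ev : unitInterval → C(unitInterval, E) →L[ℝ] E := fun t ↦ ContinuousMap.evalCLM ℝ t
  have hev : ∀ t u, ev t u = u t := fun t u ↦ rfl
  have hpathL : ∀ x y, ‖path x - path y‖ ≤ 4 / 3 * ‖x - y‖ := by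
    intro x y
    have h1 : path x - path y = cst (x - y) + pathIntegral E (Nm (path x) - Nm (path y)) := by
      conv_lhs => rw [heq x, heq y]
      rw [map_sub, map_sub]
      abel
    have h2 : ‖cst (x - y)‖ ≤ ‖x - y‖ := by
      rw [ContinuousMap.norm_le _ (norm_nonneg _)]
      intro t
      rw [hcst]
    have h3 := (norm_pathIntegral_le (Nm (path x) - Nm (path y))).trans (hNlip _ _)
    have h4 := norm_add_le (cst (x - y)) (pathIntegral E (Nm (path x) - Nm (path y)))
    rw [← h1] at h4
    linarith
  have hflow : ∀ t : unitInterval, ∃ Φ : E ≃ₜ E, (∀ x, Φ x = path x t) ∧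
      ContDiff ℝ ∞ Φ ∧ ContDiff ℝ ∞ Φ.symm := by
    intro t
    have hsm : ContDiff ℝ ∞ fun x ↦ ev t (pathIntegral E (Nm (path x))) :=
      (ev t).contDiff.comp ((pathIntegral E).contDiff.comp (hNm.comp hpath))
    have hlip : LipschitzWith (1 / 3) fun x ↦ ev t (pathIntegral E (Nm (path x))) := by
      refine LipschitzWith.of_dist_le_mul fun x y ↦ ?_
      rw [dist_eq_norm, dist_eq_norm, ← map_sub, ← map_sub, hev]
      have h1 := ContinuousMap.norm_coe_le_norm
        (pathIntegral E (Nm (path x) - Nm (path y))) t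
      have h2 := (norm_pathIntegral_le (Nm (path x) - Nm (path y))).trans (hNlip _ _)
      have h3 := hpathL x y
      push_cast
      linarith
    obtain ⟨Φ, h1, h2, h3⟩ := exists_homeomorph_id_add hsm (by
      rw [← NNReal.coe_lt_coe]; norm_num) hlip
    refine ⟨Φ, fun x ↦ ?_, h2, h3⟩
    rw [h1]
    conv_rhs => rw [heq x]
    rfl
  choose Φ hΦ hΦs hΦi using hflow
  have hfd : ∀ t x v, fderiv ℝ (Φ t) x v = fderiv ℝ path x v t := by
    intro t x v
    have h1 : (Φ t : E → E) = fun x ↦ ev t (path x) := funext fun x ↦ hΦ t x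
    have h2 : HasFDerivAt (fun x ↦ ev t (path x)) ((ev t).comp (fderiv ℝ path x)) x :=
      (ev t).hasFDerivAt.comp x (hpath.differentiable (by simp) x).hasFDerivAt
    rw [h1, h2.fderiv]
    rfl
  have hvar : ∀ x v, fderiv ℝ path x v = cst v +
      pathIntegral E (pointwiseApply unitInterval E E (X'.comp (path x)) (fderiv ℝ path x v)) := by
    intro x v
    have h0 := (hpath.differentiable (by simp) x).hasFDerivAt
    have h1 := (hasFDerivAt_comp_continuousMap Xc X' hX' (path x)).comp x h0
    have h2 := cst.hasFDerivAt (x := x) |>.add ((pathIntegral E).hasFDerivAt.comp x h1)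
    have h4 := h0.unique (h2.congr_of_eventuallyEq (Eventually.of_forall fun y ↦ heq y))
    conv_lhs => rw [h4]
    rfl
  refine ⟨fun t ↦ Φ (projIcc 0 1 zero_le_one t), ?_, fun t ↦ hΦs _, fun t ↦ hΦi _, ?_, ?_, ?_⟩
  · intro x
    rw [hΦ, heq, ContinuousMap.add_apply, pathIntegral_apply, hcst]
    simp
  · intro x hx t
    have h0 : Nm (cst x) = 0 := by
      ext t
      exact hx
    have h1 : path x = cst x := by
      rw [S.symm_apply_eq, hS, h0]
      simp
    rw [hΦ, h1, hcst]
  · intro t ht x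
    simp only [hΦ]
    exact hasDerivWithinAt_of_eq_pathIntegral (fun t ↦ congrArg (fun w ↦ w t) (heq x)) ht
  · intro t ht x v
    simp only [hΦ, hfd]
    exact hasDerivWithinAt_of_eq_pathIntegral (fun t ↦ congrArg (fun w ↦ w t) (hvar x v)) ht

end Flow

/-! ### Exact symplectic maps and Hamiltonian flows on a normed space -/

section ExteriorDerivative

variable {E : Type*} [NormedAddCommGroup E] [NormedSpace ℝ E]
  {F : Type*} [NormedAddCommGroup F] [NormedSpace ℝ F]

/-- The exterior derivative of a 1-form on a normed space. -/
noncomputable def extDerivOneForm (β : E → E →L[ℝ] ℝ) (x u v : E) : ℝ :=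
  fderiv ℝ β x u v - fderiv ℝ β x v u

/-- The exterior derivative commutes with pullback. -/
theorem extDerivOneForm_pullback {β : F → F →L[ℝ] ℝ} {f : E → F} {x : E}
    (hβ : DifferentiableAt ℝ β (f x)) (hf : ContDiffAt ℝ 2 f x) (u v : E) :
    extDerivOneForm (fun y ↦ (β (f y)).comp (fderiv ℝ f y)) x u v =
      extDerivOneForm β (f x) (fderiv ℝ f x u) (fderiv ℝ f x v) := by
  have hf1 : HasFDerivAt f (fderiv ℝ f x) x := (hf.differentiableAt (by simp)).hasFDerivAt
  have hf2 : HasFDerivAt (fderiv ℝ f) (fderiv ℝ (fderiv ℝ f) x) x :=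
    ((hf.fderiv_right (m := 1) (by norm_num [one_add_one_eq_two])).differentiableAt
      (by simp)).hasFDerivAt
  have hsymm : IsSymmSndFDerivAt ℝ f x := hf.isSymmSndFDerivAt (by simp)
  have h := (hβ.hasFDerivAt.comp x hf1).clm_comp hf2
  have h' : fderiv ℝ (fun y ↦ (β (f y)).comp (fderiv ℝ f y)) x = _ := h.fderiv
  have := hsymm u v
  simp only [extDerivOneForm, h']
  simp [this]

end ExteriorDerivative

section HamiltonianFlows

variable {E : Type*} [NormedAddCommGroup E] [NormedSpace ℝ E]

/-- `χ` is a smooth diffeomorphism of `E`, equal to the identity outside of `S`. -/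
structure IsSupportedDiffeo (S : Set E) (χ : E ≃ₜ E) : Prop where
  contDiff : ContDiff ℝ ∞ χ
  contDiff_symm : ContDiff ℝ ∞ χ.symm
  eq_self : ∀ x ∉ S, χ x = x

theorem IsSupportedDiffeo.symm {S : Set E} {χ : E ≃ₜ E} (h : IsSupportedDiffeo S χ) :
    IsSupportedDiffeo S χ.symm :=
  ⟨h.contDiff_symm, h.contDiff, fun x hx ↦ by rw [χ.symm_apply_eq, h.eq_self x hx]⟩

theorem IsSupportedDiffeo.trans {S : Set E} {χ ψ : E ≃ₜ E} (h : IsSupportedDiffeo S χ)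
    (h' : IsSupportedDiffeo S ψ) : IsSupportedDiffeo S (χ.trans ψ) :=
  ⟨h'.contDiff.comp h.contDiff, h.contDiff_symm.comp h'.contDiff_symm, fun x hx ↦ by
    rw [Homeomorph.trans_apply, h.eq_self x hx, h'.eq_self x hx]⟩

theorem IsSupportedDiffeo.mapsTo {S : Set E} {χ : E ≃ₜ E} (h : IsSupportedDiffeo S χ) {x : E}
    (hx : x ∈ S) : χ x ∈ S := by
  by_contra hn
  have h1 := χ.injective (h.eq_self _ hn)
  exact hn (h1.symm ▸ hx)

/-- `χ` is a diffeomorphism of `E`, equal to the identity outside of `S`, that preserves the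
1-form `β`. -/
structure IsExactSymplectic (β : E → E →L[ℝ] ℝ) (S : Set E) (χ : E ≃ₜ E) : Prop
    extends IsSupportedDiffeo S χ where
  pullback_eq : ∀ x, (β (χ x)).comp (fderiv ℝ χ x) = β x

/-- `φ` is the flow, for times in `[0,1]`, of the autonomous Hamiltonian `h` with respect to `dβ`,
where `h` vanishes and `φ` is the identity outside of `S`. -/
structure IsLocalHamiltonianFlow (β : E → E →L[ℝ] ℝ) (S : Set E) (h : E → ℝ) (φ : ℝ → E ≃ₜ E) :
    Prop where
  contDiff_ham : ContDiff ℝ ∞ h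
  ham_eq_zero : ∀ x ∉ S, h x = 0
  supported : ∀ t, IsSupportedDiffeo S (φ t)
  map_zero : ∀ x, φ 0 x = x
  hasDeriv : ∀ t ∈ Icc (0 : ℝ) 1, ∀ x, ∃ v : E,
    (∀ w, extDerivOneForm β (φ t x) v w = fderiv ℝ h (φ t x) w) ∧
      HasDerivWithinAt (fun τ ↦ φ τ x) v (Icc 0 1) t

theorem IsLocalHamiltonianFlow.mono {β : E → E →L[ℝ] ℝ} {S S' : Set E} {h : E → ℝ}
    {φ : ℝ → E ≃ₜ E} (hφ : IsLocalHamiltonianFlow β S h φ) (hS : S ⊆ S') :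
    IsLocalHamiltonianFlow β S' h φ where
  contDiff_ham := hφ.contDiff_ham
  ham_eq_zero x hx := hφ.ham_eq_zero x fun h ↦ hx (hS h)
  supported t := ⟨(hφ.supported t).contDiff, (hφ.supported t).contDiff_symm,
    fun x hx ↦ (hφ.supported t).eq_self x fun h ↦ hx (hS h)⟩
  map_zero := hφ.map_zero
  hasDeriv := hφ.hasDeriv

/-- Exact symplectic maps conjugate Hamiltonian flows to Hamiltonian flows. -/
theorem IsLocalHamiltonianFlow.conj {β : E → E →L[ℝ] ℝ} {S : Set E} {h : E → ℝ} {φ : ℝ → E ≃ₜ E}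
    (hβ : Differentiable ℝ β) (hφ : IsLocalHamiltonianFlow β S h φ) {χ : E ≃ₜ E}
    (hχ : IsExactSymplectic β S χ) :
    IsLocalHamiltonianFlow β S (h ∘ χ.symm) (fun t ↦ (χ.symm.trans (φ t)).trans χ) where
  contDiff_ham := hφ.contDiff_ham.comp hχ.contDiff_symm
  ham_eq_zero x hx := by
    rw [Function.comp_apply, hχ.symm.eq_self x hx, hφ.ham_eq_zero x hx]
  supported t := (hχ.symm.trans (hφ.supported t)).trans hχ.toIsSupportedDiffeo
  map_zero x := by simp [hφ.map_zero]
  hasDeriv t ht x := by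
    obtain ⟨v, hv, hd⟩ := hφ.hasDeriv t ht (χ.symm x)
    set y := φ t (χ.symm x) with hy
    have hχd : HasFDerivAt χ (fderiv ℝ χ y) y :=
      (hχ.contDiff.differentiable (by simp) y).hasFDerivAt
    have hχsd : HasFDerivAt χ.symm (fderiv ℝ χ.symm (χ y)) (χ y) :=
      (hχ.contDiff_symm.differentiable (by simp) _).hasFDerivAt
    have hinv : ∀ w, fderiv ℝ χ y (fderiv ℝ χ.symm (χ y) w) = w := by
      intro w
      have h1 : HasFDerivAt (χ ∘ χ.symm)
          ((fderiv ℝ χ y).comp (fderiv ℝ χ.symm (χ y))) (χ y) := by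
        refine HasFDerivAt.comp _ ?_ hχsd
        rwa [χ.symm_apply_apply]
      have h2 : (χ ∘ χ.symm : E → E) = id := by
        ext z
        simp
      rw [h2] at h1
      exact congrArg (fun L : E →L[ℝ] E ↦ L w) (h1.unique (hasFDerivAt_id _))
    refine ⟨fderiv ℝ χ y v, fun w ↦ ?_, ?_⟩
    · change extDerivOneForm β (χ y) _ w = fderiv ℝ (h ∘ χ.symm) (χ y) w
      have h1 := extDerivOneForm_pullback (hβ (χ y))
        (contDiff_infty.1 hχ.contDiff 2).contDiffAt
        v (fderiv ℝ χ.symm (χ y) w)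
      rw [hinv] at h1
      rw [← h1, funext hχ.pullback_eq, hv]
      have hh : HasFDerivAt h (fderiv ℝ h y) (χ.symm (χ y)) := by
        rw [χ.symm_apply_apply]
        exact (hφ.contDiff_ham.differentiable (by simp) y).hasFDerivAt
      rw [(hh.comp _ hχsd).fderiv]
      rfl
    · exact hχd.comp_hasDerivWithinAt t hd

variable [CompleteSpace E]

/-- A vector field `X` with `ι_X dβ = dh` and `β X = -h` preserves `β`, because the Lie derivative
is `L_X β = d (β X) + ι_X dβ = 0`. Its flow is therefore exact symplectic. -/
theorem exists_hamiltonianFlow {β : E → E →L[ℝ] ℝ} {S : Set E} {h : E → ℝ} {X : E → E}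
    (hβ : Differentiable ℝ β) (hh : ContDiff ℝ ∞ h) (hX : ContDiff ℝ ∞ X)
    (hL : LipschitzWith (1 / 4) X) (hhS : ∀ x ∉ S, h x = 0) (hXS : ∀ x ∉ S, X x = 0)
    (hgrad : ∀ x w, extDerivOneForm β x (X x) w = fderiv ℝ h x w)
    (hβX : ∀ x, β x (X x) = -h x) :
    ∃ φ : ℝ → E ≃ₜ E, IsLocalHamiltonianFlow β S h φ ∧ IsExactSymplectic β S (φ 1) ∧
      ∀ t ∈ Icc (0 : ℝ) 1, ∀ x,
        HasDerivWithinAt (fun τ ↦ φ τ x) (X (φ t x)) (Icc 0 1) t := by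
  obtain ⟨φ, h0, hs, hi, hz, hd, hv⟩ := exists_smooth_flow X hX hL
  refine ⟨φ, ⟨hh, hhS, fun t ↦ ⟨hs t, hi t, fun x hx ↦ hz x (hXS x hx) t⟩, h0,
    fun t ht x ↦ ⟨_, hgrad _, hd t ht x⟩⟩,
    ⟨⟨hs 1, hi 1, fun x hx ↦ hz x (hXS x hx) 1⟩, fun x ↦ ?_⟩, hd⟩
  ext v
  have hder : ∀ t ∈ Icc (0 : ℝ) 1,
      HasDerivWithinAt (fun τ ↦ β (φ τ x) (fderiv ℝ (φ τ) x v)) 0 (Icc 0 1) t := by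
    intro t ht
    have h1 := (hβ (φ t x)).hasFDerivAt.comp_hasDerivWithinAt t (hd t ht x)
    have h2 := h1.clm_apply (hv t ht x v)
    refine h2.congr_deriv ?_
    have h3 : HasFDerivAt (fun y ↦ β y (X y)) _ (φ t x) :=
      (hβ (φ t x)).hasFDerivAt.clm_apply (hX.differentiable (by simp) (φ t x)).hasFDerivAt
    have h4 : HasFDerivAt (fun y ↦ β y (X y)) (-fderiv ℝ h (φ t x)) (φ t x) := by
      simp only [hβX]
      exact (hh.differentiable (by simp) (φ t x)).hasFDerivAt.neg
    have h5 := congrArg (fun L : E →L[ℝ] ℝ ↦ L (fderiv ℝ (φ t) x v)) (h3.unique h4)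
    have h6 := hgrad (φ t x) (fderiv ℝ (φ t) x v)
    simp [extDerivOneForm] at h5 h6
    -- This is `L_X β = 0`, applied to the transported vector.
    have h7 : fderiv ℝ β (φ t x) (X (φ t x)) (fderiv ℝ (φ t) x v) +
        β (φ t x) (fderiv ℝ X (φ t x) (fderiv ℝ (φ t) x v)) = 0 := by linarith
    exact h7
  have hconst := constant_of_derivWithin_zero (fun t ht ↦ (hder t ht).differentiableWithinAt)
    (fun t ht ↦ (hder t (Ico_subset_Icc_self ht)).derivWithin
      (uniqueDiffOn_Icc zero_lt_one t (Ico_subset_Icc_self ht))) 1 (right_mem_Icc.2 zero_le_one)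
  have h8 : (φ 0 : E → E) = id := funext h0
  simpa [h8] using hconst

end HamiltonianFlows

/-! ### Contact Hamiltonians in a chart -/

section Lift

variable {E : Type*} [NormedAddCommGroup E] [NormedSpace ℝ E]

/-- The 1-form `e^s A` on `ℝ × E`, for a 1-form `A` on `E`. -/
noncomputable def expLift (A : E → E →L[ℝ] ℝ) (p : ℝ × E) : ℝ × E →L[ℝ] ℝ :=
  Real.exp p.1 • (A p.2).comp (ContinuousLinearMap.snd ℝ ℝ E)

theorem hasFDerivAt_expLift {A : E → E →L[ℝ] ℝ} {p : ℝ × E} (hA : DifferentiableAt ℝ A p.2) :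
    HasFDerivAt (expLift A)
      (Real.exp p.1 • ((ContinuousLinearMap.compL ℝ (ℝ × E) E ℝ).flip
          (ContinuousLinearMap.snd ℝ ℝ E)).comp
          ((fderiv ℝ A p.2).comp (ContinuousLinearMap.snd ℝ ℝ E)) +
        (Real.exp p.1 • ContinuousLinearMap.fst ℝ ℝ E).smulRight
          ((A p.2).comp (ContinuousLinearMap.snd ℝ ℝ E))) p := by
  have h1 : HasFDerivAt (fun p : ℝ × E ↦ Real.exp p.1)
      (Real.exp p.1 • ContinuousLinearMap.fst ℝ ℝ E) p := hasFDerivAt_fst.exp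
  have h2 : HasFDerivAt (fun p : ℝ × E ↦ A p.2) _ p := hA.hasFDerivAt.comp p hasFDerivAt_snd
  have h3 := ((ContinuousLinearMap.compL ℝ (ℝ × E) E ℝ).flip
    (ContinuousLinearMap.snd ℝ ℝ E)).hasFDerivAt.comp p h2
  exact h1.smul h3

theorem extDerivOneForm_expLift {A : E → E →L[ℝ] ℝ} {p : ℝ × E}
    (hA : DifferentiableAt ℝ A p.2) (u v : ℝ × E) :
    extDerivOneForm (expLift A) p u v =
      Real.exp p.1 * (u.1 * A p.2 v.2 - v.1 * A p.2 u.2 + extDerivOneForm A p.2 u.2 v.2) := by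
  rw [extDerivOneForm, (hasFDerivAt_expLift hA).fderiv]
  simp [extDerivOneForm]
  ring

end Lift

section ContactField

variable {E : Type*} [NormedAddCommGroup E] [NormedSpace ℝ E]

/-- The linear map `(a, Y) ↦ (-A(Y), a A + ι_Y dA)` at the point `x`. It sends the pair consisting
of the `s`-component and the `E`-component of the Hamiltonian vector field of `e^s g` to
`(g, dg)`. -/
noncomputable def contactSystem (A : E → E →L[ℝ] ℝ) (x : E) :
    ℝ × E →L[ℝ] ℝ × (E →L[ℝ] ℝ) :=
  (-(A x).comp (ContinuousLinearMap.snd ℝ ℝ E)).prod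
    ((ContinuousLinearMap.fst ℝ ℝ E).smulRight (A x) +
      (fderiv ℝ A x - (fderiv ℝ A x).flip).comp (ContinuousLinearMap.snd ℝ ℝ E))

theorem contactSystem_fst (A : E → E →L[ℝ] ℝ) (x : E) (p : ℝ × E) :
    (contactSystem A x p).1 = -A x p.2 := by
  simp [contactSystem]

theorem contactSystem_snd (A : E → E →L[ℝ] ℝ) (x : E) (p : ℝ × E) (w : E) :
    (contactSystem A x p).2 w = p.1 * A x w + extDerivOneForm A x p.2 w := by
  simp [contactSystem, extDerivOneForm]

theorem contDiff_contactSystem [FiniteDimensional ℝ E] {A : E → E →L[ℝ] ℝ} (hA : ContDiff ℝ ∞ A) :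
    ContDiff ℝ ∞ (contactSystem A) := by
  have hA' : ContDiff ℝ ∞ (fderiv ℝ A) := hA.fderiv_right (by simp)
  have h1 : ∀ u, ContDiff ℝ ∞ fun x ↦ (fderiv ℝ A x).flip u := fun u ↦
    contDiff_clm_apply_iff.2 fun v ↦ (hA'.clm_apply contDiff_const).clm_apply contDiff_const
  refine contDiff_clm_apply_iff.2 fun p ↦ ?_
  exact (hA.clm_apply contDiff_const).neg.prodMk
    ((contDiff_const.smul hA).add ((hA'.clm_apply contDiff_const).sub (h1 p.2)))

/-- `A` is a contact form at the point `x`, with Reeb vector `R`. -/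
structure IsContactAt (A : E → E →L[ℝ] ℝ) (x R : E) : Prop where
  nondegenerate : ∀ u, A x u = 0 → (∀ v, A x v = 0 → extDerivOneForm A x u v = 0) → u = 0
  reeb_apply : A x R = 1
  reeb_extDeriv : ∀ v, extDerivOneForm A x R v = 0

theorem extDerivOneForm_swap (A : E → E →L[ℝ] ℝ) (x u v : E) :
    extDerivOneForm A x u v = -extDerivOneForm A x v u := by
  simp [extDerivOneForm]

/-- The system is invertible where `A` is contact: a pair `(a, Y)` in its kernel has `a = 0`, by
evaluation on the Reeb vector, and then `Y = 0` by nondegeneracy. -/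
theorem IsContactAt.isInvertible [FiniteDimensional ℝ E] {A : E → E →L[ℝ] ℝ} {x R : E}
    (h : IsContactAt A x R) :
    (contactSystem A x).IsInvertible := by
  have hinj : Function.Injective (contactSystem A x : ℝ × E →ₗ[ℝ] ℝ × (E →L[ℝ] ℝ)) := by
    rw [← LinearMap.ker_eq_bot, LinearMap.ker_eq_bot']
    intro p hp
    have h1 : A x p.2 = 0 := by
      rw [← neg_eq_zero, ← contactSystem_fst]
      exact congrArg Prod.fst hp
    have h2 : ∀ w, p.1 * A x w + extDerivOneForm A x p.2 w = 0 := fun w ↦ by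
      rw [← contactSystem_snd]
      exact congrArg (fun q : ℝ × (E →L[ℝ] ℝ) ↦ q.2 w) hp
    have h3 : p.1 = 0 := by
      have := h2 R
      rwa [h.reeb_apply, extDerivOneForm_swap, h.reeb_extDeriv, neg_zero, add_zero,
        mul_one] at this
    have h4 : p.2 = 0 := h.nondegenerate _ h1 fun v _ ↦ by simpa [h3] using h2 v
    exact Prod.ext h3 h4
  have hdim : Module.finrank ℝ (ℝ × E) = Module.finrank ℝ (ℝ × (E →L[ℝ] ℝ)) := by
    have : Module.finrank ℝ (E →L[ℝ] ℝ) = Module.finrank ℝ E := by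
      rw [← (LinearMap.toContinuousLinearMap : (E →ₗ[ℝ] ℝ) ≃ₗ[ℝ] _).finrank_eq]
      exact Subspace.dual_finrank_eq
    rw [Module.finrank_prod, Module.finrank_prod, this]
  refine ⟨(LinearEquiv.ofInjectiveOfFinrankEq _ hinj hdim).toContinuousLinearEquiv, ?_⟩
  ext p <;> rfl

/-- Near a point where `A` is contact, every function `g` is the contact Hamiltonian of a vector
field; the pair `V = (a, Y)` is the Hamiltonian vector field of `e^s g` on `ℝ × E`, which does not
depend on `s`. -/
theorem IsContactAt.exists_contactField [FiniteDimensional ℝ E] {A : E → E →L[ℝ] ℝ}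
    (hA : ContDiff ℝ ∞ A) {x₀ R : E} (h : IsContactAt A x₀ R) :
    ∃ U ∈ 𝓝 x₀, ∀ g : E → ℝ, ContDiff ℝ ∞ g → tsupport g ⊆ U →
      ∃ V : E → ℝ × E, ContDiff ℝ ∞ V ∧ (∀ x ∉ tsupport g, V x = 0) ∧
        (∀ x, A x (V x).2 = -g x) ∧
        ∀ x w, (V x).1 * A x w + extDerivOneForm A x (V x).2 w = fderiv ℝ g x w := by
  have hT := contDiff_contactSystem hA
  -- Invertibility is an open condition, so it persists on a neighbourhood of `x₀`.
  refine ⟨contactSystem A ⁻¹' range ((↑) : ((ℝ × E) ≃L[ℝ] ℝ × (E →L[ℝ] ℝ)) → _),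
    hT.continuous.continuousAt.preimage_mem_nhds
      (ContinuousLinearEquiv.isOpen.mem_nhds h.isInvertible), fun g hg hgU ↦ ?_⟩
  have hg' : ContDiff ℝ ∞ (fderiv ℝ g) := hg.fderiv_right (by simp)
  have hzero : ∀ x ∉ tsupport g, (contactSystem A x).inverse (g x, fderiv ℝ g x) = 0 := by
    intro x hx
    have h1 : fderiv ℝ g x = 0 := by
      by_contra hne
      exact hx (support_fderiv_subset ℝ hne)
    rw [image_eq_zero_of_notMem_tsupport hx, h1]
    exact map_zero _
  have hinv : ∀ x, contactSystem A x ((contactSystem A x).inverse (g x, fderiv ℝ g x)) =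
      (g x, fderiv ℝ g x) := by
    intro x
    by_cases hx : x ∈ tsupport g
    · obtain ⟨e, he⟩ := hgU hx
      rw [← he, ContinuousLinearMap.inverse_equiv]
      exact e.apply_symm_apply _
    · rw [hzero x hx, map_zero, image_eq_zero_of_notMem_tsupport hx]
      have h1 : fderiv ℝ g x = 0 := by
        by_contra hne
        exact hx (support_fderiv_subset ℝ hne)
      rw [h1]
      rfl
  refine ⟨fun x ↦ (contactSystem A x).inverse (g x, fderiv ℝ g x), ?_, hzero, fun x ↦ ?_,
    fun x w ↦ ?_⟩
  · rw [contDiff_iff_contDiffAt]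
    intro x
    by_cases hx : x ∈ tsupport g
    · have h1 : ContDiffAt ℝ ∞ (fun x ↦ (contactSystem A x).inverse) x :=
        ContDiffAt.comp x (ContinuousLinearMap.IsInvertible.contDiffAt_map_inverse (hgU hx))
          hT.contDiffAt
      exact h1.clm_apply (hg.contDiffAt.prodMk hg'.contDiffAt)
    · refine (contDiffAt_const (c := (0 : ℝ × E))).congr_of_eventuallyEq ?_
      filter_upwards [(isClosed_tsupport g).isOpen_compl.mem_nhds hx] with y hy
      exact hzero y hy
  · have h1 := contactSystem_fst A x ((contactSystem A x).inverse (g x, fderiv ℝ g x))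
    rw [hinv] at h1
    exact (neg_eq_iff_eq_neg.2 h1).symm.trans (by simp) |>.trans rfl
  · rw [← contactSystem_snd, hinv]

/-- The model contact Hamiltonian `A₀ ξ + ½ (D_ξ A) ξ`, `ξ = x - x₀`. -/
noncomputable def modelHamiltonian (A : E → E →L[ℝ] ℝ) (x₀ x : E) : ℝ :=
  A x₀ (x - x₀) + 1 / 2 * fderiv ℝ A x₀ (x - x₀) (x - x₀)

theorem hasFDerivAt_modelHamiltonian (A : E → E →L[ℝ] ℝ) (x₀ x : E) :
    HasFDerivAt (modelHamiltonian A x₀) (A x₀ + (1 / 2 : ℝ) •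
      (fderiv ℝ A x₀ (x - x₀) + (fderiv ℝ A x₀).flip (x - x₀))) x := by
  have h1 : HasFDerivAt (fun x ↦ x - x₀) (ContinuousLinearMap.id ℝ E) x :=
    (hasFDerivAt_id x).sub_const x₀
  have h2 : HasFDerivAt (fun x ↦ A x₀ (x - x₀)) _ x := (A x₀).hasFDerivAt.comp x h1
  have h3 : HasFDerivAt (fun x ↦ fderiv ℝ A x₀ (x - x₀)) _ x :=
    (fderiv ℝ A x₀).hasFDerivAt.comp x h1
  refine (h2.add ((h3.clm_apply h1).const_mul (1 / 2 : ℝ))).congr_fderiv ?_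
  ext v
  simp

theorem contDiff_modelHamiltonian (A : E → E →L[ℝ] ℝ) (x₀ : E) :
    ContDiff ℝ ∞ (modelHamiltonian A x₀) := by
  have h1 : ContDiff ℝ ∞ fun x : E ↦ x - x₀ := contDiff_id.sub contDiff_const
  exact ((A x₀).contDiff.comp h1).add
    (contDiff_const.mul (((fderiv ℝ A x₀).contDiff.comp h1).clm_apply h1))

/-- The contact vector field of the model Hamiltonian vanishes at `x₀` and its linearization there
is `-½` on the contact hyperplane and `-1` on the Reeb direction; the `s`-component is `1`. -/
theorem IsContactAt.linearization {A : E → E →L[ℝ] ℝ} (hA : ContDiff ℝ ∞ A) {x₀ R : E}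
    (h : IsContactAt A x₀ R) {g : E → ℝ} (hg : g =ᶠ[𝓝 x₀] modelHamiltonian A x₀)
    {V : E → ℝ × E} (hV : ContDiff ℝ ∞ V) (hV1 : ∀ x, A x (V x).2 = -g x)
    (hV2 : ∀ x w, (V x).1 * A x w + extDerivOneForm A x (V x).2 w = fderiv ℝ g x w) :
    V x₀ = (1, 0) ∧ ∀ u, (fderiv ℝ V x₀ u).2 = -(1 / 2 : ℝ) • (u + A x₀ u • R) := by
  have hR : ∀ v, extDerivOneForm A x₀ v R = 0 := fun v ↦ by
    rw [extDerivOneForm_swap, h.reeb_extDeriv, neg_zero]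
  have hDg : ∀ᶠ x in 𝓝 x₀, fderiv ℝ g x = A x₀ + (1 / 2 : ℝ) •
      (fderiv ℝ A x₀ (x - x₀) + (fderiv ℝ A x₀).flip (x - x₀)) := by
    filter_upwards [hg.eventually_nhds] with x hx
    exact ((hasFDerivAt_modelHamiltonian A x₀ x).congr_of_eventuallyEq hx).fderiv
  have hg0 : g x₀ = 0 := by
    rw [hg.self_of_nhds]
    simp [modelHamiltonian]
  have hDg0 : fderiv ℝ g x₀ = A x₀ := by
    rw [hDg.self_of_nhds]
    simp
  have ha : (V x₀).1 = 1 := by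
    have := hV2 x₀ R
    rwa [hR, hDg0, h.reeb_apply, mul_one, add_zero] at this
  have hY : (V x₀).2 = 0 := by
    refine h.nondegenerate _ (by rw [hV1, hg0, neg_zero]) fun v hv ↦ ?_
    have := hV2 x₀ v
    rw [hDg0, hv] at this
    linarith
  refine ⟨Prod.ext ha hY, fun u ↦ ?_⟩
  have hVd : HasFDerivAt V (fderiv ℝ V x₀) x₀ := (hV.differentiable (by simp) x₀).hasFDerivAt
  have hAd : HasFDerivAt A (fderiv ℝ A x₀) x₀ := (hA.differentiable (by simp) x₀).hasFDerivAt
  have hA2 : HasFDerivAt (fderiv ℝ A) (fderiv ℝ (fderiv ℝ A) x₀) x₀ :=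
    ((hA.fderiv_right (m := ∞) (by simp)).differentiable (by simp) x₀).hasFDerivAt
  have hVd2 : HasFDerivAt (fun x ↦ (V x).2) _ x₀ := hasFDerivAt_snd.comp x₀ hVd
  have hVd1 : HasFDerivAt (fun x ↦ (V x).1) _ x₀ := hasFDerivAt_fst.comp x₀ hVd
  have hgd : HasFDerivAt g (A x₀) x₀ := by
    have := hasFDerivAt_modelHamiltonian A x₀ x₀
    simp only [sub_self, map_zero, add_zero, smul_zero] at this
    exact this.congr_of_eventuallyEq hg
  -- The derivatives at `x₀` of the two equations `hV1` and `hV2` that define `V`.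
  have e1 : A x₀ (fderiv ℝ V x₀ u).2 = -A x₀ u := by
    have h1 := hAd.clm_apply hVd2
    have h2 : HasFDerivAt (fun x ↦ A x (V x).2) (-A x₀) x₀ := by
      simp only [hV1]
      exact hgd.neg
    have h3 := congrArg (fun L : E →L[ℝ] ℝ ↦ L u) (h1.unique h2)
    simpa [hY] using h3
  have e2 : ∀ w, (fderiv ℝ V x₀ u).1 * A x₀ w + fderiv ℝ A x₀ u w +
      extDerivOneForm A x₀ (fderiv ℝ V x₀ u).2 w =
        1 / 2 * (fderiv ℝ A x₀ u w + fderiv ℝ A x₀ w u) := by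
    intro w
    have h1 := (hVd1.mul (hAd.clm_apply (hasFDerivAt_const w x₀))).add
      (((hA2.clm_apply hVd2).clm_apply (hasFDerivAt_const w x₀)).sub
        ((hA2.clm_apply (hasFDerivAt_const w x₀)).clm_apply hVd2))
    have hsub : HasFDerivAt (fun x ↦ x - x₀) (ContinuousLinearMap.id ℝ E) x₀ :=
      (hasFDerivAt_id x₀).sub_const x₀
    have h2 : HasFDerivAt (fun x ↦ A x₀ w + (1 / 2 : ℝ) * (fderiv ℝ A x₀ (x - x₀) w +
        fderiv ℝ A x₀ w (x - x₀))) _ x₀ :=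
      (hasFDerivAt_const (A x₀ w) x₀).add (HasFDerivAt.const_mul
        ((((fderiv ℝ A x₀).hasFDerivAt.comp x₀ hsub).clm_apply (hasFDerivAt_const w x₀)).add
          ((fderiv ℝ A x₀ w).hasFDerivAt.comp x₀ hsub)) (1 / 2 : ℝ))
    have h3 := h1.unique (h2.congr_of_eventuallyEq (by
      filter_upwards [hDg] with x hx
      have := hV2 x w
      rw [hx] at this
      simp [extDerivOneForm] at this ⊢
      linarith))
    have h4 := congrArg (fun L : E →L[ℝ] ℝ ↦ L u) h3
    simp [hY, ha] at h4
    simp only [extDerivOneForm]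
    linarith
  -- Evaluated on `R`, the terms of `e2` with the derivative of `A` cancel since `ι_R dA = 0`.
  have e3 : (fderiv ℝ V x₀ u).1 = 0 := by
    have h1 := e2 R
    have h2 := hR u
    rw [hR, h.reeb_apply] at h1
    simp only [extDerivOneForm] at h2
    linarith
  have e4 : (fderiv ℝ V x₀ u).2 + (1 / 2 : ℝ) • (u + A x₀ u • R) = 0 := by
    refine h.nondegenerate _ ?_ fun v _ ↦ ?_
    · simp only [map_add, map_smul, smul_eq_mul, e1, h.reeb_apply]
      ring
    · have h1 := e2 v
      have h2 := h.reeb_extDeriv v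
      rw [e3] at h1
      simp only [extDerivOneForm, map_add, map_smul, add_apply,
        smul_apply, smul_eq_mul] at h1 h2 ⊢
      linear_combination h1 + 1 / 2 * A x₀ u * h2
  rw [neg_smul]
  exact eq_neg_of_add_eq_zero_left e4

end ContactField

/-! ### A trapping region whose points are pushed to infinity -/

section Trapping

variable {E : Type*} [NormedAddCommGroup E] [InnerProductSpace ℝ E]

/-- The quadratic form `(ℓ ξ)² + |ξ - (ℓ ξ) R|²`, positive definite and adapted to the splitting of
`E` into the line of `R` and the kernel of `ℓ`. -/
noncomputable def splitQuadratic (ℓ : E →L[ℝ] ℝ) (R ξ : E) : ℝ :=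
  ℓ ξ ^ 2 + ‖ξ - ℓ ξ • R‖ ^ 2

/-- The derivative of `splitQuadratic` at `ξ` in the direction `η`. -/
noncomputable def splitQuadraticDeriv (ℓ : E →L[ℝ] ℝ) (R ξ η : E) : ℝ :=
  2 * (ℓ ξ * ℓ η + inner ℝ (ξ - ℓ ξ • R) (η - ℓ η • R))

theorem splitQuadraticDeriv_add (ℓ : E →L[ℝ] ℝ) (R ξ η ζ : E) :
    splitQuadraticDeriv ℓ R ξ (η + ζ) =
      splitQuadraticDeriv ℓ R ξ η + splitQuadraticDeriv ℓ R ξ ζ := by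
  have h : η + ζ - ℓ (η + ζ) • R = (η - ℓ η • R) + (ζ - ℓ ζ • R) := by
    rw [map_add, add_smul]
    abel
  rw [splitQuadraticDeriv, h, inner_add_right, map_add, splitQuadraticDeriv, splitQuadraticDeriv]
  ring

theorem splitQuadraticDeriv_smul (ℓ : E →L[ℝ] ℝ) (R ξ η : E) (a : ℝ) :
    splitQuadraticDeriv ℓ R ξ (a • η) = a * splitQuadraticDeriv ℓ R ξ η := by
  have h : a • η - ℓ (a • η) • R = a • (η - ℓ η • R) := by
    rw [map_smul, smul_sub, smul_assoc]
  rw [splitQuadraticDeriv, h, inner_smul_right, map_smul, smul_eq_mul, splitQuadraticDeriv]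
  ring

theorem HasDerivWithinAt.splitQuadratic {ℓ : E →L[ℝ] ℝ} {R : E} {f : ℝ → E} {f' : E} {s : Set ℝ}
    {t : ℝ} (hf : HasDerivWithinAt f f' s t) :
    HasDerivWithinAt (fun τ ↦ splitQuadratic ℓ R (f τ)) (splitQuadraticDeriv ℓ R (f t) f') s t := by
  have h1 : HasDerivWithinAt (fun τ ↦ ℓ (f τ)) (ℓ f') s t :=
    ℓ.hasFDerivAt.comp_hasDerivWithinAt t hf
  have h2 := (h1.pow 2).add (hf.sub (h1.smul_const R)).norm_sq
  refine h2.congr_deriv ?_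
  simp [splitQuadraticDeriv]
  ring

theorem continuous_splitQuadratic (ℓ : E →L[ℝ] ℝ) (R : E) : Continuous (splitQuadratic ℓ R) := by
  unfold splitQuadratic
  fun_prop

theorem norm_sq_le_splitQuadratic (ℓ : E →L[ℝ] ℝ) (R ξ : E) :
    ‖ξ‖ ^ 2 ≤ 2 * (‖R‖ ^ 2 + 1) * splitQuadratic ℓ R ξ := by
  have h1 : ‖ξ‖ ≤ |ℓ ξ| * ‖R‖ + ‖ξ - ℓ ξ • R‖ := by
    calc ‖ξ‖ = ‖ℓ ξ • R + (ξ - ℓ ξ • R)‖ := by rw [add_sub_cancel]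
      _ ≤ _ := (norm_add_le _ _).trans (by rw [norm_smul, Real.norm_eq_abs])
  have h2 : ‖ξ‖ ^ 2 ≤ (|ℓ ξ| * ‖R‖ + ‖ξ - ℓ ξ • R‖) ^ 2 :=
    pow_le_pow_left₀ (norm_nonneg _) h1 2
  rw [splitQuadratic, ← sq_abs (ℓ ξ)]
  nlinarith [sq_nonneg (|ℓ ξ| * ‖R‖ - ‖ξ - ℓ ξ • R‖), sq_nonneg (|ℓ ξ|),
    sq_nonneg (‖R‖ * ‖ξ - ℓ ξ • R‖)]

/-- Along the linear contraction `ξ ↦ -½ (ξ + (ℓ ξ) R)` the quadratic form decays. -/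
theorem splitQuadraticDeriv_contraction {ℓ : E →L[ℝ] ℝ} {R : E} (hR : ℓ R = 1) (ξ : E) :
    splitQuadraticDeriv ℓ R ξ (-(1 / 2 : ℝ) • (ξ + ℓ ξ • R)) ≤ -splitQuadratic ℓ R ξ := by
  rw [splitQuadraticDeriv_smul]
  have h : ξ + ℓ ξ • R - ℓ (ξ + ℓ ξ • R) • R = ξ - ℓ ξ • R := by
    rw [map_add, map_smul, hR, smul_eq_mul, mul_one, add_smul]
    abel
  rw [splitQuadraticDeriv, h, real_inner_self_eq_norm_sq, splitQuadratic, map_add, map_smul, hR,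
    smul_eq_mul]
  nlinarith [sq_nonneg (ℓ ξ)]

theorem abs_splitQuadraticDeriv_le (ℓ : E →L[ℝ] ℝ) (R ξ η : E) :
    |splitQuadraticDeriv ℓ R ξ η| ≤ 2 * (‖ℓ‖ ^ 2 + (1 + ‖ℓ‖ * ‖R‖) ^ 2) * ‖ξ‖ * ‖η‖ := by
  have hP : ∀ ζ : E, ‖ζ - ℓ ζ • R‖ ≤ (1 + ‖ℓ‖ * ‖R‖) * ‖ζ‖ := by
    intro ζ
    refine (norm_sub_le _ _).trans ?_
    rw [norm_smul]
    have := mul_le_mul_of_nonneg_right (ℓ.le_opNorm ζ) (norm_nonneg R)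
    linarith
  have h1 : |ℓ ξ * ℓ η| ≤ (‖ℓ‖ * ‖ξ‖) * (‖ℓ‖ * ‖η‖) := by
    rw [abs_mul]
    exact mul_le_mul (ℓ.le_opNorm ξ) (ℓ.le_opNorm η) (abs_nonneg _) (by positivity)
  have h2 : |inner ℝ (ξ - ℓ ξ • R) (η - ℓ η • R)| ≤
      ((1 + ‖ℓ‖ * ‖R‖) * ‖ξ‖) * ((1 + ‖ℓ‖ * ‖R‖) * ‖η‖) :=
    (abs_real_inner_le_norm _ _).trans (mul_le_mul (hP ξ) (hP η) (norm_nonneg _) (by positivity))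
  rw [splitQuadraticDeriv, abs_mul, abs_two]
  have h3 := abs_add_le (ℓ ξ * ℓ η) (inner ℝ (ξ - ℓ ξ • R) (η - ℓ η • R))
  linarith

/-- A vector field with linearization `ξ ↦ -½ (ξ + (ℓ ξ) R)` at its zero `x₀` points into small
sublevel sets of the quadratic form. -/
theorem eventually_splitQuadraticDeriv_neg {ℓ : E →L[ℝ] ℝ} {R : E} (hR : ℓ R = 1) {Y : E → E}
    {L : E →L[ℝ] E} {x₀ : E} (hY0 : Y x₀ = 0) (hY : HasFDerivAt Y L x₀)
    (hL : ∀ u, L u = -(1 / 2 : ℝ) • (u + ℓ u • R)) :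
    ∀ᶠ x in 𝓝 x₀, 0 < splitQuadratic ℓ R (x - x₀) →
      splitQuadraticDeriv ℓ R (x - x₀) (Y x) < 0 := by
  set C := 2 * (‖ℓ‖ ^ 2 + (1 + ‖ℓ‖ * ‖R‖) ^ 2) with hC
  set M := 2 * (‖R‖ ^ 2 + 1) with hM
  have hC0 : 0 < C := by positivity
  have hM0 : 0 < M := by positivity
  have hlo := (hasFDerivAt_iff_isLittleO.1 hY)
  rw [Asymptotics.isLittleO_iff] at hlo
  filter_upwards [hlo (c := (2 * C * M)⁻¹) (by positivity)] with x hx hpos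
  rw [hY0, sub_zero] at hx
  have h1 : Y x = L (x - x₀) + (Y x - L (x - x₀)) := by abel
  rw [h1, splitQuadraticDeriv_add, hL]
  rw [hL] at hx
  have h2 := splitQuadraticDeriv_contraction hR (x - x₀)
  have h3 := (le_abs_self _).trans (abs_splitQuadraticDeriv_le ℓ R (x - x₀)
    (Y x - -(1 / 2 : ℝ) • (x - x₀ + ℓ (x - x₀) • R)))
  have h4 := norm_sq_le_splitQuadratic ℓ R (x - x₀)
  rw [← hC] at h3
  rw [← hM] at h4
  have h5 : C * ‖x - x₀‖ * ‖Y x - -(1 / 2 : ℝ) • (x - x₀ + ℓ (x - x₀) • R)‖ ≤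
      C * ‖x - x₀‖ * ((2 * C * M)⁻¹ * ‖x - x₀‖) := by gcongr
  have h6 : C * ‖x - x₀‖ * ((2 * C * M)⁻¹ * ‖x - x₀‖) = (2 * M)⁻¹ * ‖x - x₀‖ ^ 2 := by
    field_simp
  have h7 : (2 * M)⁻¹ * ‖x - x₀‖ ^ 2 ≤ (2 * M)⁻¹ * (M * splitQuadratic ℓ R (x - x₀)) := by
    gcongr
  have h8 : (2 * M)⁻¹ * (M * splitQuadratic ℓ R (x - x₀)) =
      splitQuadratic ℓ R (x - x₀) / 2 := by
    field_simp
  linarith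

end Trapping

section Pushing

variable {E : Type*} [NormedAddCommGroup E] [InnerProductSpace ℝ E] [FiniteDimensional ℝ E]

/-- Near a contact point `x₀` there is a Hamiltonian `e^s g` on `ℝ × E`, supported over an
arbitrarily small compact neighbourhood `K` of `x₀`, whose time-one map preserves `ℝ × P` for some
neighbourhood `P` of `x₀` and increases the coordinate `s` there by at least `c > 0`. -/
theorem IsContactAt.exists_pushing_hamiltonian {A : E → E →L[ℝ] ℝ} (hA : ContDiff ℝ ∞ A) {x₀ R : E}
    (h : IsContactAt A x₀ R) {W : Set E} (hW : W ∈ 𝓝 x₀) :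
    ∃ K ⊆ W, IsCompact K ∧ ∃ P ∈ 𝓝 x₀, P ⊆ K ∧ ∃ c > 0,
      ∃ (g : E → ℝ) (C : ℝ) (φ : ℝ → (ℝ × E) ≃ₜ (ℝ × E)), (∀ x, |g x| ≤ C) ∧
      IsLocalHamiltonianFlow (expLift A) (univ ×ˢ K) (fun p ↦ Real.exp p.1 * g p.2) φ ∧
      IsExactSymplectic (expLift A) (univ ×ˢ K) (φ 1) ∧
      ∀ s, ∀ x ∈ P, (φ 1 (s, x)).2 ∈ P ∧ s + c ≤ (φ 1 (s, x)).1 := by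
  obtain ⟨U, hU, hfield⟩ := h.exists_contactField hA
  obtain ⟨ρ, hρ, hball⟩ := Metric.nhds_basis_closedBall.mem_iff.1 (inter_mem hW hU)
  let b : ContDiffBump x₀ := ⟨ρ / 2, ρ, by positivity, by linarith⟩
  have hb : ContDiff ℝ ∞ b := b.contDiff
  let g₁ : E → ℝ := fun x ↦ b x * modelHamiltonian A x₀ x
  have hg₁ : ContDiff ℝ ∞ g₁ := hb.mul (contDiff_modelHamiltonian A x₀)
  have hsupp : tsupport g₁ ⊆ Metric.closedBall x₀ ρ := by
    rw [← show tsupport b = Metric.closedBall x₀ ρ from b.tsupport_eq]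
    exact tsupport_mul_subset_left
  have hg₁c : HasCompactSupport g₁ := b.hasCompactSupport.mul_right
  obtain ⟨V, hV, hV0, hV1, hV2⟩ := hfield g₁ hg₁ (hsupp.trans fun x hx ↦ (hball hx).2)
  have hg₁near : g₁ =ᶠ[𝓝 x₀] modelHamiltonian A x₀ := by
    filter_upwards [b.eventuallyEq_one] with x hx
    simp [g₁, hx]
  obtain ⟨hVx, hVlin⟩ := h.linearization hA hg₁near hV hV1 hV2
  have hVc : HasCompactSupport V := HasCompactSupport.intro hg₁c hV0
  obtain ⟨L, hL⟩ := hV.lipschitzWith_of_hasCompactSupport hVc (by simp)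
  -- The factor `ε` makes the Lipschitz constant small enough for the existence of the flow.
  let ε : ℝ := (4 * (L + 1))⁻¹
  have hε : 0 < ε := by positivity
  have hεL : LipschitzWith (1 / 4) fun p : ℝ × E ↦ ε • V p.2 := by
    refine LipschitzWith.of_dist_le_mul fun p q ↦ ?_
    rw [dist_smul₀, Real.norm_of_nonneg hε.le]
    have h1 := hL.dist_le_mul p.2 q.2
    have h2 : dist p.2 q.2 ≤ dist p q := le_max_right _ _
    have h3 : ε * L ≤ 1 / 4 := by
      rw [inv_mul_le_iff₀ (by positivity)]
      linarith [L.2]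
    calc ε * dist (V p.2) (V q.2) ≤ ε * (L * dist p q) := by gcongr; exact h1.trans (by gcongr)
      _ = ε * L * dist p q := by ring
      _ ≤ 1 / 4 * dist p q := by gcongr
      _ = _ := by push_cast; rfl
  have hXsm : ContDiff ℝ ∞ fun p : ℝ × E ↦ ε • V p.2 := (hV.comp contDiff_snd).const_smul ε
  have hhsm : ContDiff ℝ ∞ fun p : ℝ × E ↦ Real.exp p.1 * (ε * g₁ p.2) :=
    contDiff_fst.exp.mul (contDiff_const.mul (hg₁.comp contDiff_snd))
  have hAd : Differentiable ℝ A := hA.differentiable (by simp)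
  obtain ⟨φ, hφ, hφ1, hφd⟩ := exists_hamiltonianFlow
    (S := univ ×ˢ Metric.closedBall x₀ ρ) (X := fun p : ℝ × E ↦ ε • V p.2)
    (h := fun p : ℝ × E ↦ Real.exp p.1 * (ε * g₁ p.2))
    (fun p ↦ (hasFDerivAt_expLift (hAd p.2)).differentiableAt) hhsm hXsm hεL
    (fun p hp ↦ by
      have : p.2 ∉ tsupport g₁ := fun hx ↦ hp ⟨mem_univ _, hsupp hx⟩
      simp [image_eq_zero_of_notMem_tsupport this])
    (fun p hp ↦ by
      have : p.2 ∉ tsupport g₁ := fun hx ↦ hp ⟨mem_univ _, hsupp hx⟩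
      simp [hV0 _ this])
    (fun p w ↦ by
      have h1 : HasFDerivAt (fun p : ℝ × E ↦ g₁ p.2) _ p :=
        ((hg₁.differentiable (by simp) p.2).hasFDerivAt).comp p hasFDerivAt_snd
      have h2 : HasFDerivAt (fun p : ℝ × E ↦ Real.exp p.1 * (ε * g₁ p.2)) _ p :=
        (hasFDerivAt_fst.exp).mul (h1.const_mul ε)
      have h3 := hV2 p.2 w.2
      have h4 := hV1 p.2
      rw [extDerivOneForm_expLift (hAd p.2), h2.fderiv]
      simp [extDerivOneForm] at h3 ⊢
      rw [h4, ← h3]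
      ring)
    (fun p ↦ by
      simp [expLift, hV1]
      ring)
  -- Choice of the sublevel set `P` of the quadratic form.
  have hVd : HasFDerivAt V (fderiv ℝ V x₀) x₀ := (hV.differentiable (by simp) x₀).hasFDerivAt
  have hVd2 : HasFDerivAt (fun x ↦ (V x).2) _ x₀ := hasFDerivAt_snd.comp x₀ hVd
  have hneg := eventually_splitQuadraticDeriv_neg h.reeb_apply (by rw [hVx]) hVd2 hVlin
  have hpos : ∀ᶠ x in 𝓝 x₀, 1 / 2 ≤ (V x).1 := by
    have h1 : ContinuousAt (fun x ↦ (V x).1) x₀ := hV.continuous.fst.continuousAt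
    refine (h1.eventually (lt_mem_nhds (a := (1 / 2 : ℝ)) ?_)).mono fun x hx ↦ hx.le
    simp only [hVx]
    norm_num
  obtain ⟨δ, hδ, hδball⟩ := Metric.eventually_nhds_iff.1 (hneg.and hpos)
  let M := 2 * (‖R‖ ^ 2 + 1)
  have hM : 0 < M := by positivity
  let r := δ ^ 2 / (2 * M)
  have hr : 0 < r := by positivity
  have hsub : ∀ x, splitQuadratic (A x₀) R (x - x₀) ≤ r → dist x x₀ < δ := by
    intro x hx
    rw [dist_eq_norm]
    refine lt_of_pow_lt_pow_left₀ 2 hδ.le ?_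
    calc ‖x - x₀‖ ^ 2 ≤ M * splitQuadratic (A x₀) R (x - x₀) := norm_sq_le_splitQuadratic _ _ _
      _ ≤ M * r := by gcongr
      _ = δ ^ 2 / 2 := by simp only [r]; field_simp
      _ < δ ^ 2 := by linarith [pow_pos hδ 2]
  refine ⟨Metric.closedBall x₀ ρ, fun x hx ↦ (hball hx).1, isCompact_closedBall x₀ ρ,
    {x | splitQuadratic (A x₀) R (x - x₀) ≤ r}, ?_, ?_, ε / 2, by positivity, fun x ↦ ε * g₁ x, ?_⟩
  · have hc : Continuous fun x ↦ splitQuadratic (A x₀) R (x - x₀) :=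
      (continuous_splitQuadratic _ _).comp (continuous_id.sub continuous_const)
    have h0 : splitQuadratic (A x₀) R (x₀ - x₀) < r := by simpa [splitQuadratic] using hr
    exact (hc.continuousAt.eventually (gt_mem_nhds h0)).mono fun x hx ↦ hx.le
  · intro x hx
    have h1 := (hδball (hsub x hx)).2
    by_contra hn
    rw [hV0 x fun h ↦ hn (hsupp h)] at h1
    norm_num at h1
  obtain ⟨C, hC⟩ := hg₁c.exists_bound_of_continuous hg₁.continuous
  refine ⟨ε * C, φ, fun x ↦ ?_, hφ, hφ1, fun s x hx ↦ ?_⟩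
  · rw [abs_mul, abs_of_pos hε]
    exact mul_le_mul_of_nonneg_left (hC x) hε.le
  have hd1 : ∀ t ∈ Icc (0 : ℝ) 1, HasDerivWithinAt (fun τ ↦ (φ τ (s, x)).1)
      (ε * (V (φ t (s, x)).2).1) (Icc 0 1) t := fun t ht ↦
    (ContinuousLinearMap.fst ℝ ℝ E).hasFDerivAt.comp_hasDerivWithinAt t (hφd t ht (s, x))
  have hd2 : ∀ t ∈ Icc (0 : ℝ) 1, HasDerivWithinAt (fun τ ↦ (φ τ (s, x)).2)
      (ε • (V (φ t (s, x)).2).2) (Icc 0 1) t := fun t ht ↦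
    (ContinuousLinearMap.snd ℝ ℝ E).hasFDerivAt.comp_hasDerivWithinAt t (hφd t ht (s, x))
  have hdQ : ∀ t ∈ Icc (0 : ℝ) 1,
      HasDerivWithinAt (fun τ ↦ splitQuadratic (A x₀) R ((φ τ (s, x)).2 - x₀))
        (ε * splitQuadraticDeriv (A x₀) R ((φ t (s, x)).2 - x₀) (V (φ t (s, x)).2).2)
          (Icc 0 1) t := fun t ht ↦ by
    have := ((hd2 t ht).sub_const x₀).splitQuadratic (ℓ := A x₀) (R := R)
    rwa [splitQuadraticDeriv_smul] at this
  have hright : ∀ {f : ℝ → ℝ} {f' t : ℝ}, t ∈ Ico (0 : ℝ) 1 →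
      HasDerivWithinAt f f' (Icc 0 1) t → HasDerivWithinAt f f' (Ici t) t := by
    intro f f' t ht hf
    refine (hf.mono (Icc_subset_Icc_left ht.1)).mono_of_mem_nhdsWithin ?_
    exact Icc_mem_nhdsGE ht.2
  have htrap : ∀ ⦃t⦄, t ∈ Icc (0 : ℝ) 1 →
      splitQuadratic (A x₀) R ((φ t (s, x)).2 - x₀) ≤ r := by
    refine image_le_of_deriv_right_lt_deriv_boundary
      (fun t ht ↦ (hdQ t ht).continuousWithinAt)
      (fun t ht ↦ hright ht (hdQ t (Ico_subset_Icc_self ht))) (B := fun _ ↦ r) (B' := fun _ ↦ 0)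
      ?_ (fun t ↦ hasDerivAt_const t r) fun t ht heq ↦ ?_
    · rw [hφ.map_zero]
      exact hx
    · exact mul_neg_of_pos_of_neg hε ((hδball (hsub _ heq.le)).1 (heq ▸ hr))
  refine ⟨htrap (right_mem_Icc.2 zero_le_one), ?_⟩
  have hle : ∀ ⦃t⦄, t ∈ Icc (0 : ℝ) 1 → s + ε / 2 * t ≤ (φ t (s, x)).1 := by
    refine image_le_of_deriv_right_le_deriv_boundary (f' := fun _ ↦ ε / 2) ?_ ?_ ?_
      (fun t ht ↦ (hd1 t ht).continuousWithinAt)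
      (fun t ht ↦ hright ht (hd1 t (Ico_subset_Icc_self ht))) fun t ht ↦ ?_
    · fun_prop
    · intro t ht
      have := ((hasDerivAt_id t).const_mul (ε / 2)).const_add s
      simpa using this.hasDerivWithinAt
    · simp [hφ.map_zero]
    · have h1 := (hδball (hsub _ (htrap (Ico_subset_Icc_self ht)))).2
      have := mul_le_mul_of_nonneg_left h1 hε.le
      linarith
  have := hle (right_mem_Icc.2 zero_le_one)
  simpa using this

end Pushing

/-! ### One-forms in charts -/

section FormsInCharts

variable {E : Type*} [NormedAddCommGroup E] [NormedSpace ℝ E] {H : Type*} [TopologicalSpace H]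
  {I : ModelWithCorners ℝ E H} [I.Boundaryless] {M : Type*} [TopologicalSpace M]
  [ChartedSpace H M] [IsManifold I ∞ M]

theorem mfderiv_extChartAt_symm_apply {x₀ q : M} (hq : q ∈ (extChartAt I x₀).source)
    (u : TangentSpace I q) :
    (mfderiv 𝓘(ℝ, E) I (extChartAt I x₀).symm (extChartAt I x₀ q) : E →L[ℝ] E)
      ((mfderiv I 𝓘(ℝ, E) (extChartAt I x₀) q : E →L[ℝ] E) u) = u := by
  have : IsManifold I 1 M := .of_le (n := ∞) (by simp)
  have h := mfderivWithin_extChartAt_symm_comp_mfderiv_extChartAt' (I := I) hq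
  rw [I.range_eq_univ, mfderivWithin_univ] at h
  exact congrArg (fun L : E →L[ℝ] E ↦ L u) h

theorem mfderiv_extChartAt_apply {x₀ q : M} (hq : q ∈ (extChartAt I x₀).source) (u : E) :
    (mfderiv I 𝓘(ℝ, E) (extChartAt I x₀) q : E →L[ℝ] E)
      ((mfderiv 𝓘(ℝ, E) I (extChartAt I x₀).symm (extChartAt I x₀ q) : E →L[ℝ] E) u) = u := by
  have : IsManifold I 1 M := .of_le (n := ∞) (by simp)
  have h := mfderiv_extChartAt_comp_mfderivWithin_extChartAt_symm' (I := I) hq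
  rw [I.range_eq_univ, mfderivWithin_univ] at h
  exact congrArg (fun L : E →L[ℝ] E ↦ L u) h

theorem oneFormInChart_mfderiv (α : Π x : M, TangentSpace I x →L[ℝ] ℝ) {x₀ q : M}
    (hq : q ∈ (extChartAt I x₀).source) (u : TangentSpace I q) :
    oneFormInChart I α x₀ (extChartAt I x₀ q) (mfderiv I 𝓘(ℝ, E) (extChartAt I x₀) q u) =
      α q u := by
  have h1 : ∀ w : M, w = q → (α w : E →L[ℝ] ℝ) = (α q : E →L[ℝ] ℝ) := by
    rintro w rfl
    rfl
  have h2 := h1 _ ((extChartAt I x₀).left_inv hq)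
  have h3 := mfderiv_extChartAt_symm_apply hq u
  change (α ((extChartAt I x₀).symm (extChartAt I x₀ q)) : E →L[ℝ] ℝ)
    ((mfderiv 𝓘(ℝ, E) I (extChartAt I x₀).symm (extChartAt I x₀ q) : E →L[ℝ] E)
      ((mfderiv I 𝓘(ℝ, E) (extChartAt I x₀) q : E →L[ℝ] E) u)) = _
  rw [h2, h3]
  rfl

theorem oneFormInChart_self (α : Π x : M, TangentSpace I x →L[ℝ] ℝ) (p : M) (u : E) :
    oneFormInChart I α p (extChartAt I p p) u = (α p : E →L[ℝ] ℝ) u := by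
  have : IsManifold I 1 M := .of_le (n := ∞) (by simp)
  have h := oneFormInChart_mfderiv α (mem_extChartAt_source p) u
  rw [mfderiv_extChartAt_self] at h
  exact h

/-- The exterior derivative can be computed in any chart. -/
theorem oneFormExtDeriv_eq (α : Π x : M, TangentSpace I x →L[ℝ] ℝ) {x₀ q : M}
    (hq : q ∈ (extChartAt I x₀).source)
    (hd : DifferentiableAt ℝ (oneFormInChart I α x₀) (extChartAt I x₀ q))
    (u v : TangentSpace I q) :
    oneFormExtDeriv I α q u v = extDerivOneForm (oneFormInChart I α x₀) (extChartAt I x₀ q)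
      (mfderiv I 𝓘(ℝ, E) (extChartAt I x₀) q u) (mfderiv I 𝓘(ℝ, E) (extChartAt I x₀) q v) := by
  have : IsManifold I 1 M := .of_le (n := ∞) (by simp)
  -- The two coordinate expressions differ by pullback along the transition map `τ`.
  set τ : E → E := extChartAt I x₀ ∘ (extChartAt I q).symm with hτ
  have hτsm : ∀ᶠ z in 𝓝 (extChartAt I q q), z ∈ (extChartAt I q).target ∧
      (extChartAt I q).symm z ∈ (extChartAt I x₀).source := by
    have hc := continuousAt_extChartAt_symm (I := I) q
    exact inter_mem (extChartAt_target_mem_nhds (I := I) q)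
      (hc.preimage_mem_nhds ((isOpen_extChartAt_source x₀).mem_nhds (by
        rwa [extChartAt_to_inv])))
  have hsymm : ∀ z ∈ (extChartAt I q).target,
      ContMDiffAt 𝓘(ℝ, E) I ∞ (extChartAt I q).symm z := fun z hz ↦
    (contMDiffOn_extChartAt_symm q).contMDiffAt ((isOpen_extChartAt_target q).mem_nhds hz)
  have hchart : ∀ w ∈ (extChartAt I x₀).source, ContMDiffAt I 𝓘(ℝ, E) ∞ (extChartAt I x₀) w :=
    fun w hw ↦ contMDiffAt_extChartAt' (by rwa [extChartAt_source] at hw)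
  have hτ' : ∀ z ∈ (extChartAt I q).target, (extChartAt I q).symm z ∈ (extChartAt I x₀).source →
      ContMDiffAt 𝓘(ℝ, E) 𝓘(ℝ, E) ∞ τ z ∧ ∀ η, fderiv ℝ τ z η =
        (mfderiv I 𝓘(ℝ, E) (extChartAt I x₀) ((extChartAt I q).symm z) : E →L[ℝ] E)
          ((mfderiv 𝓘(ℝ, E) I (extChartAt I q).symm z : E →L[ℝ] E) η) := by
    intro z hz hz'
    refine ⟨(hchart _ hz').comp z (hsymm z hz), fun η ↦ ?_⟩
    have h1 := mfderiv_comp z ((hchart _ hz').mdifferentiableAt (by simp))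
      ((hsymm z hz).mdifferentiableAt (by simp))
    rw [← hτ, mfderiv_eq_fderiv] at h1
    exact congrArg (fun L : E →L[ℝ] E ↦ L η) h1
  have heq : oneFormInChart I α q =ᶠ[𝓝 (extChartAt I q q)]
      fun z ↦ (oneFormInChart I α x₀ (τ z)).comp (fderiv ℝ τ z) := by
    filter_upwards [hτsm] with z hz
    ext η
    rw [ContinuousLinearMap.comp_apply, (hτ' z hz.1 hz.2).2]
    exact (oneFormInChart_mfderiv α hz.2 _).symm
  have hτq : τ (extChartAt I q q) = extChartAt I x₀ q := by
    simp [hτ]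
  have hfd : ∀ η : E, fderiv ℝ τ (extChartAt I q q) η =
      (mfderiv I 𝓘(ℝ, E) (extChartAt I x₀) q : E →L[ℝ] E) η := by
    intro η
    have hs := hτsm.self_of_nhds
    rw [(hτ' _ hs.1 hs.2).2]
    have h1 := mfderivWithin_range_extChartAt_symm (I := I) (x := q)
    rw [I.range_eq_univ, mfderivWithin_univ] at h1
    have h2 : (mfderiv 𝓘(ℝ, E) I (extChartAt I q).symm (extChartAt I q q) : E →L[ℝ] E) η = η :=
      congrArg (fun L : E →L[ℝ] E ↦ L η) h1
    rw [h2]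
    have h3 : ∀ w : M, w = q → (mfderiv I 𝓘(ℝ, E) (extChartAt I x₀) w : E →L[ℝ] E) =
        (mfderiv I 𝓘(ℝ, E) (extChartAt I x₀) q : E →L[ℝ] E) := by
      rintro w rfl
      rfl
    exact congrArg (fun L : E →L[ℝ] E ↦ L η) (h3 _ (extChartAt_to_inv q))
  have hτ2 : ContDiffAt ℝ 2 τ (extChartAt I q q) := by
    have hs := hτsm.self_of_nhds
    exact (hτ' _ hs.1 hs.2).1.contDiffAt.of_le (WithTop.coe_le_coe.2 le_top)
  have hpull : ∀ u v : E, oneFormExtDeriv I α q u v =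
      extDerivOneForm (oneFormInChart I α x₀) (extChartAt I x₀ q)
        ((mfderiv I 𝓘(ℝ, E) (extChartAt I x₀) q : E →L[ℝ] E) u)
        ((mfderiv I 𝓘(ℝ, E) (extChartAt I x₀) q : E →L[ℝ] E) v) := by
    intro u v
    rw [← hfd, ← hfd, ← hτq, ← extDerivOneForm_pullback (by rwa [hτq]) hτ2]
    simp only [oneFormExtDeriv, extDerivOneForm]
    rw [heq.fderiv_eq]
  exact hpull u v

/-- A smooth 1-form has smooth coordinate expressions. -/
theorem IsSmoothOneForm.contDiffOn_oneFormInChart {α : Π x : M, TangentSpace I x →L[ℝ] ℝ}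
    (hα : IsSmoothOneForm I α) (x₀ : M) :
    ContDiffOn ℝ ∞ (oneFormInChart I α x₀) (extChartAt I x₀).target := by
  have : IsManifold I 1 M := .of_le (n := ∞) (by simp)
  rw [← contMDiffOn_iff_contDiffOn]
  let T := trivializationAt (E →L[ℝ] ℝ)
    (fun y : M ↦ (TangentSpace I y →L[ℝ] Bundle.Trivial M ℝ y)) x₀
  have h1 : ContMDiffOn I 𝓘(ℝ, E →L[ℝ] ℝ) ∞ (fun x : M ↦ (T (Bundle.TotalSpace.mk' (E →L[ℝ] ℝ)
      (E := fun y : M ↦ (TangentSpace I y →L[ℝ] Bundle.Trivial M ℝ y)) x (α x))).2)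
      (chartAt H x₀).source := by
    have h2 := (T.contMDiffOn_iff (IB := I) (n := ∞) (f := fun x : M ↦
      (Bundle.TotalSpace.mk' (E →L[ℝ] ℝ)
      (E := fun y : M ↦ (TangentSpace I y →L[ℝ] Bundle.Trivial M ℝ y)) x (α x)))
      (s := (chartAt H x₀).source) (IM := I) (fun x hx ↦ by
        rw [T.mem_source]
        simpa [T] using hx)).1 hα.contMDiffOn
    exact h2.2
  have h3 := h1.comp (contMDiffOn_extChartAt_symm (I := I) (n := ∞) x₀) (fun z hz ↦ by
    have := (extChartAt I x₀).map_target hz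
    rwa [extChartAt_source] at this)
  refine h3.congr fun z hz ↦ ?_
  have hw : (extChartAt I x₀).symm z ∈ (chartAt H x₀).source := by
    have := (extChartAt I x₀).map_target hz
    rwa [extChartAt_source] at this
  ext u
  have h4 := TangentBundle.symmL_trivializationAt (I := I) hw
  rw [I.range_eq_univ, mfderivWithin_univ, (extChartAt I x₀).right_inv hz] at h4
  simp only [Function.comp_apply, T, hom_trivializationAt_apply,
    ContinuousLinearMap.inCoordinates, oneFormInChart]
  rw [h4]
  simp

end FormsInCharts

/-! ### Extending local Hamiltonian flows from a chart to the manifold -/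

section ChartExtension

variable {E : Type*} [NormedAddCommGroup E] [NormedSpace ℝ E] {H : Type*} [TopologicalSpace H]
  (I : ModelWithCorners ℝ E H) {M : Type*} [TopologicalSpace M] [ChartedSpace H M]

open Classical in
/-- The extension by the identity to `M` of a self-map of the model space, read in the preferred
chart at `x₀`. -/
noncomputable def chartExtend (x₀ : M) (f : E → E) (q : M) : M :=
  if q ∈ (extChartAt I x₀).source then (extChartAt I x₀).symm (f (extChartAt I x₀ q)) else q

open Classical in
/-- The extension by zero to `M` of a function on the model space, read in the preferred chart
at `x₀`. -/
noncomputable def chartExtendZero (x₀ : M) (h : E → ℝ) (q : M) : ℝ :=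
  if q ∈ (extChartAt I x₀).source then h (extChartAt I x₀ q) else 0

/-- `S` is a set in the domain of the chart at `x₀`, read in the chart, that is closed in `M`. -/
structure IsChartSupport (x₀ : M) (S : Set E) : Prop where
  subset_target : S ⊆ (extChartAt I x₀).target
  isClosed : IsClosed ((extChartAt I x₀).symm '' S)

variable {I} {x₀ : M} {S : Set E}

theorem chartExtend_of_mem {f : E → E} {q : M} (hq : q ∈ (extChartAt I x₀).source) :
    chartExtend I x₀ f q = (extChartAt I x₀).symm (f (extChartAt I x₀ q)) := if_pos hq

theorem chartExtendZero_of_mem {h : E → ℝ} {q : M} (hq : q ∈ (extChartAt I x₀).source) :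
    chartExtendZero I x₀ h q = h (extChartAt I x₀ q) := if_pos hq

theorem mem_image_extChartAt_symm {q : M}
    (hq : q ∈ (extChartAt I x₀).source) (hqS : extChartAt I x₀ q ∈ S) :
    q ∈ (extChartAt I x₀).symm '' S :=
  ⟨_, hqS, (extChartAt I x₀).left_inv hq⟩

theorem chartExtend_of_notMem {f : E → E}
    (hf : ∀ x ∉ S, f x = x) {q : M} (hq : q ∉ (extChartAt I x₀).symm '' S) :
    chartExtend I x₀ f q = q := by
  by_cases h : q ∈ (extChartAt I x₀).source
  · rw [chartExtend_of_mem h, hf _ fun hS' ↦ hq (mem_image_extChartAt_symm h hS'),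
      (extChartAt I x₀).left_inv h]
  · exact if_neg h

theorem chartExtendZero_of_notMem {h : E → ℝ}
    (hh : ∀ x ∉ S, h x = 0) {q : M} (hq : q ∉ (extChartAt I x₀).symm '' S) :
    chartExtendZero I x₀ h q = 0 := by
  by_cases h : q ∈ (extChartAt I x₀).source
  · rw [chartExtendZero_of_mem h, hh _ fun hS' ↦ hq (mem_image_extChartAt_symm h hS')]
  · exact if_neg h

theorem IsChartSupport.mapsTo_target (hS : IsChartSupport I x₀ S) {χ : E ≃ₜ E}
    (hχ : IsSupportedDiffeo S χ) {z : E} (hz : z ∈ (extChartAt I x₀).target) :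
    χ z ∈ (extChartAt I x₀).target := by
  by_cases h : z ∈ S
  · exact hS.subset_target (hχ.mapsTo h)
  · rwa [hχ.eq_self z h]

theorem IsChartSupport.chartExtend_comp (hS : IsChartSupport I x₀ S) {χ : E ≃ₜ E}
    (hχ : IsSupportedDiffeo S χ) (f : E → E) (q : M) :
    chartExtend I x₀ f (chartExtend I x₀ χ q) = chartExtend I x₀ (f ∘ χ) q := by
  by_cases h : q ∈ (extChartAt I x₀).source
  · have h1 := hS.mapsTo_target hχ ((extChartAt I x₀).map_source h)
    rw [chartExtend_of_mem h, chartExtend_of_mem ((extChartAt I x₀).map_target h1),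
      chartExtend_of_mem h, (extChartAt I x₀).right_inv h1, Function.comp_apply]
  · have h1 : ∀ f : E → E, chartExtend I x₀ f q = q := fun f ↦ if_neg h
    rw [h1, h1, h1]

theorem chartExtend_id (q : M) : chartExtend I x₀ id q = q :=
  chartExtend_of_notMem (S := ∅) (fun _ _ ↦ rfl) (by simp)

theorem oneFormExtDeriv_zero_left (Θ : Π x : M, TangentSpace I x →L[ℝ] ℝ) (x : M)
    (w : TangentSpace I x) : oneFormExtDeriv I Θ x (0 : E) w = 0 := by
  have h : ∀ (L : E →L[ℝ] E →L[ℝ] ℝ) (w : E), L 0 w - L w 0 = 0 := by simp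
  exact h _ _

variable [IsManifold I ∞ M]

theorem IsChartSupport.contMDiff_chartExtendZero (hS : IsChartSupport I x₀ S) {h : E → ℝ}
    (hh : ContDiff ℝ ∞ h) (hh0 : ∀ x ∉ S, h x = 0) :
    ContMDiff I 𝓘(ℝ, ℝ) ∞ (chartExtendZero I x₀ h) := by
  intro q
  by_cases hq : q ∈ (extChartAt I x₀).source
  · have h1 : ContMDiffAt I 𝓘(ℝ, E) ∞ (extChartAt I x₀) q :=
      contMDiffAt_extChartAt' (by rwa [extChartAt_source] at hq)
    have h2 : ContMDiffAt 𝓘(ℝ, E) 𝓘(ℝ, ℝ) ∞ h (extChartAt I x₀ q) :=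
      hh.contMDiff.contMDiffAt
    refine (h2.comp q h1).congr_of_eventuallyEq ?_
    filter_upwards [(isOpen_extChartAt_source x₀).mem_nhds hq] with y hy
    exact chartExtendZero_of_mem hy
  · refine (contMDiffAt_const (c := (0 : ℝ))).congr_of_eventuallyEq ?_
    have hq' : q ∉ (extChartAt I x₀).symm '' S := by
      rintro ⟨z, hz, rfl⟩
      exact hq ((extChartAt I x₀).map_target (hS.subset_target hz))
    filter_upwards [hS.isClosed.isOpen_compl.mem_nhds hq'] with y hy
    exact chartExtendZero_of_notMem hh0 hy

variable [I.Boundaryless]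

theorem IsChartSupport.contMDiff_chartExtend (hS : IsChartSupport I x₀ S) {χ : E ≃ₜ E}
    (hχ : IsSupportedDiffeo S χ) : ContMDiff I I ∞ (chartExtend I x₀ χ) := by
  intro q
  by_cases hq : q ∈ (extChartAt I x₀).source
  · have h1 : ContMDiffAt I 𝓘(ℝ, E) ∞ (extChartAt I x₀) q :=
      contMDiffAt_extChartAt' (by rwa [extChartAt_source] at hq)
    have h2 : ContMDiffAt 𝓘(ℝ, E) 𝓘(ℝ, E) ∞ χ (extChartAt I x₀ q) :=
      hχ.contDiff.contMDiff.contMDiffAt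
    have h3 : ContMDiffAt 𝓘(ℝ, E) I ∞ (extChartAt I x₀).symm (χ (extChartAt I x₀ q)) :=
      (contMDiffOn_extChartAt_symm x₀).contMDiffAt ((isOpen_extChartAt_target x₀).mem_nhds
        (hS.mapsTo_target hχ ((extChartAt I x₀).map_source hq)))
    refine (h3.comp q (h2.comp q h1)).congr_of_eventuallyEq ?_
    filter_upwards [(isOpen_extChartAt_source x₀).mem_nhds hq] with y hy
    exact chartExtend_of_mem hy
  · refine contMDiffAt_id.congr_of_eventuallyEq ?_
    have hq' : q ∉ (extChartAt I x₀).symm '' S := by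
      rintro ⟨z, hz, rfl⟩
      exact hq ((extChartAt I x₀).map_target (hS.subset_target hz))
    filter_upwards [hS.isClosed.isOpen_compl.mem_nhds hq'] with y hy
    exact chartExtend_of_notMem hχ.eq_self hy

/-- The diffeomorphism of `M` that is a given supported diffeomorphism in the chart at `x₀` and the
identity elsewhere. -/
noncomputable def chartDiffeo (hS : IsChartSupport I x₀ S) {χ : E ≃ₜ E}
    (hχ : IsSupportedDiffeo S χ) : M ≃ₘ⟮I, I⟯ M where
  toFun := chartExtend I x₀ χ
  invFun := chartExtend I x₀ χ.symm
  left_inv q := by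
    rw [hS.chartExtend_comp hχ, χ.symm_comp_self, chartExtend_id]
  right_inv q := by
    rw [hS.chartExtend_comp hχ.symm, χ.self_comp_symm, chartExtend_id]
  contMDiff_toFun := hS.contMDiff_chartExtend hχ
  contMDiff_invFun := hS.contMDiff_chartExtend hχ.symm

theorem chartDiffeo_apply (hS : IsChartSupport I x₀ S) {χ : E ≃ₜ E}
    (hχ : IsSupportedDiffeo S χ) (q : M) : chartDiffeo hS hχ q = chartExtend I x₀ χ q := rfl

/-- The autonomous path of functions on `M` given by a function supported in the chart at `x₀`. -/
noncomputable def chartPath (hS : IsChartSupport I x₀ S) {h : E → ℝ} (hh : ContDiff ℝ ∞ h)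
    (hh0 : ∀ x ∉ S, h x = 0) : C(unitInterval × M, ℝ) :=
  ⟨fun p ↦ chartExtendZero I x₀ h p.2,
    (hS.contMDiff_chartExtendZero hh hh0).continuous.comp continuous_snd⟩

/-- Symplectic gradients can be computed in a chart. -/
theorem isSymplecticGradientAt_of_chart {Θ : Π x : M, TangentSpace I x →L[ℝ] ℝ}
    {β : E → E →L[ℝ] ℝ} {h : E → ℝ} {y : M} {v : E} (hy : y ∈ (extChartAt I x₀).source)
    (hβ : DifferentiableAt ℝ β (extChartAt I x₀ y))
    (hΘ : oneFormInChart I Θ x₀ =ᶠ[𝓝 (extChartAt I x₀ y)] β)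
    (hh : DifferentiableAt ℝ h (extChartAt I x₀ y))
    (hv : ∀ w, extDerivOneForm β (extChartAt I x₀ y) v w = fderiv ℝ h (extChartAt I x₀ y) w) :
    IsSymplecticGradientAt I (oneFormExtDeriv I Θ) (chartExtendZero I x₀ h) y
      ((mfderiv 𝓘(ℝ, E) I (extChartAt I x₀).symm (extChartAt I x₀ y) : E →L[ℝ] E) v) := by
  intro w
  have h1 : ∀ a b : E, extDerivOneForm (oneFormInChart I Θ x₀) (extChartAt I x₀ y) a b =
      extDerivOneForm β (extChartAt I x₀ y) a b := fun a b ↦ by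
    simp only [extDerivOneForm]
    rw [hΘ.fderiv_eq]
  have h2 := mfderiv_extChartAt_apply hy v
  have h3 : mfderiv I 𝓘(ℝ, ℝ) (chartExtendZero I x₀ h) y =
      mfderiv I 𝓘(ℝ, ℝ) (h ∘ extChartAt I x₀) y := by
    refine Filter.EventuallyEq.mfderiv_eq ?_
    filter_upwards [(isOpen_extChartAt_source x₀).mem_nhds hy] with y' hy'
    exact chartExtendZero_of_mem hy'
  have h4 : mfderiv I 𝓘(ℝ, ℝ) (h ∘ extChartAt I x₀) y =
      (fderiv ℝ h (extChartAt I x₀ y)).comp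
        (mfderiv I 𝓘(ℝ, E) (extChartAt I x₀) y : E →L[ℝ] E) := by
    have h5 : ContMDiffAt I 𝓘(ℝ, E) ∞ (extChartAt I x₀) y :=
      contMDiffAt_extChartAt' (by rwa [extChartAt_source] at hy)
    rw [mfderiv_comp y hh.mdifferentiableAt (h5.mdifferentiableAt (by simp)), mfderiv_eq_fderiv]
    rfl
  have h6 := oneFormExtDeriv_eq Θ hy (hΘ.differentiableAt_iff.2 hβ)
    ((mfderiv 𝓘(ℝ, E) I (extChartAt I x₀).symm (extChartAt I x₀ y) : E →L[ℝ] E) v) w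
  rw [h3, h4]
  refine Eq.trans ?_ h6.symm
  refine Eq.trans ?_ (h1 _ _).symm
  refine Eq.trans ?_ (congrArg (fun a : E ↦ extDerivOneForm β (extChartAt I x₀ y) a
    ((mfderiv I 𝓘(ℝ, E) (extChartAt I x₀) y : E →L[ℝ] E) w)) h2).symm
  exact (hv _).symm

/-- A local Hamiltonian flow, read in a chart in which the primitive of the symplectic form is `β`,
extends to a Hamiltonian flow on `M`. -/
theorem IsLocalHamiltonianFlow.generates {Θ : Π x : M, TangentSpace I x →L[ℝ] ℝ}
    {β : E → E →L[ℝ] ℝ} (hS : IsChartSupport I x₀ S) (hβ : Differentiable ℝ β)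
    (hΘ : ∀ z ∈ S, oneFormInChart I Θ x₀ =ᶠ[𝓝 z] β) {h : E → ℝ} {φ : ℝ → E ≃ₜ E}
    (hφ : IsLocalHamiltonianFlow β S h φ) :
    Generates I (oneFormExtDeriv I Θ) (chartPath hS hφ.contDiff_ham hφ.ham_eq_zero)
      (chartDiffeo hS (hφ.supported 1)) := by
  have hsmooth := hS.contMDiff_chartExtendZero hφ.contDiff_ham hφ.ham_eq_zero
  refine ⟨(hsmooth.comp contMDiff_snd).contMDiffOn, fun t ↦ chartDiffeo hS (hφ.supported t),
    ⟨?_, fun t ht x ↦ ?_⟩, rfl⟩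
  · refine Diffeomorph.ext fun x ↦ ?_
    have h0 : (φ 0 : E → E) = id := funext hφ.map_zero
    rw [chartDiffeo_apply, h0, chartExtend_id]
    rfl
  have hat : atTime (chartPath hS hφ.contDiff_ham hφ.ham_eq_zero) t = chartExtendZero I x₀ h := rfl
  rw [hat]
  -- Trajectories starting in `S` stay in `S`; outside of `S` the Hamiltonian vanishes locally.
  by_cases hx : x ∈ (extChartAt I x₀).symm '' S
  · obtain ⟨z, hz, rfl⟩ := hx
    obtain ⟨v, hv, hd⟩ := hφ.hasDeriv t ht z
    have hzt : ∀ τ, chartDiffeo hS (hφ.supported τ) ((extChartAt I x₀).symm z) =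
        (extChartAt I x₀).symm (φ τ z) := fun τ ↦ by
      have h1 := hS.subset_target hz
      rw [chartDiffeo_apply, chartExtend_of_mem ((extChartAt I x₀).map_target h1),
        (extChartAt I x₀).right_inv h1]
    have hφz : φ t z ∈ S := (hφ.supported t).mapsTo hz
    have hysource : chartDiffeo hS (hφ.supported t) ((extChartAt I x₀).symm z) ∈
        (extChartAt I x₀).source := by
      rw [hzt]
      exact (extChartAt I x₀).map_target (hS.subset_target hφz)
    have hey : extChartAt I x₀ (chartDiffeo hS (hφ.supported t) ((extChartAt I x₀).symm z)) =
        φ t z := by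
      rw [hzt]
      exact (extChartAt I x₀).right_inv (hS.subset_target hφz)
    refine ⟨_, isSymplecticGradientAt_of_chart hysource (hβ _) (by rw [hey]; exact hΘ _ hφz)
      (hφ.contDiff_ham.differentiable (by simp) _) (v := v) (by rw [hey]; exact hv), ?_⟩
    have h1 : HasMFDerivAt 𝓘(ℝ, E) I (extChartAt I x₀).symm (φ t z)
        (mfderiv 𝓘(ℝ, E) I (extChartAt I x₀).symm (φ t z)) :=
      (((contMDiffOn_extChartAt_symm (I := I) (n := ∞) x₀).contMDiffAt
        ((isOpen_extChartAt_target x₀).mem_nhds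
          (hS.subset_target hφz))).mdifferentiableAt (by simp)).hasMFDerivAt
    have h2 := h1.comp_hasMFDerivWithinAt t hd.hasFDerivWithinAt.hasMFDerivWithinAt
    have h3 := h2.congr_of_eventuallyEq
      (f₁ := fun τ ↦ chartDiffeo hS (hφ.supported τ) ((extChartAt I x₀).symm z))
      (Eventually.of_forall hzt) (hzt t)
    refine h3.congr_mfderiv ?_
    have h4 : ∀ a : ℝ, (mfderiv 𝓘(ℝ, E) I (extChartAt I x₀).symm (φ t z) : E →L[ℝ] E) (a • v) =
        a • (mfderiv 𝓘(ℝ, E) I (extChartAt I x₀).symm (φ t z) : E →L[ℝ] E) v :=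
      fun a ↦ map_smul _ a v
    rw [hey]
    exact ContinuousLinearMap.ext h4
  · have hconst : ∀ τ, chartDiffeo hS (hφ.supported τ) x = x := fun τ ↦
      chartExtend_of_notMem (hφ.supported τ).eq_self hx
    refine ⟨(0 : E), fun w ↦ ?_, ?_⟩
    · have h2 : mfderiv I 𝓘(ℝ, ℝ) (chartExtendZero I x₀ h) (chartDiffeo hS (hφ.supported t) x) =
          mfderiv I 𝓘(ℝ, ℝ) (fun _ ↦ (0 : ℝ)) (chartDiffeo hS (hφ.supported t) x) := by
        refine Filter.EventuallyEq.mfderiv_eq ?_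
        have hx' : chartDiffeo hS (hφ.supported t) x ∉ (extChartAt I x₀).symm '' S := by
          rwa [hconst t]
        filter_upwards [hS.isClosed.isOpen_compl.mem_nhds hx'] with y hy
        exact chartExtendZero_of_notMem hφ.ham_eq_zero hy
      rw [h2, mfderiv_const]
      exact (oneFormExtDeriv_zero_left Θ _ w).symm
    · have h1 := (hasMFDerivWithinAt_const (I := 𝓘(ℝ, ℝ)) (I' := I) x (s := Icc (0 : ℝ) 1)
        (x := t)).congr_of_eventuallyEq
          (f₁ := fun τ ↦ chartDiffeo hS (hφ.supported τ) x)
          (Eventually.of_forall hconst) (hconst t)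
      refine h1.congr_mfderiv ?_
      have h2 : ∀ a : ℝ, (0 : E) = a • (0 : E) := fun a ↦ (smul_zero a).symm
      exact ContinuousLinearMap.ext h2

end ChartExtension

/-! ### The symplectization in a chart -/

section Symplectization

variable {E : Type*} [NormedAddCommGroup E] [NormedSpace ℝ E] {H : Type*} [TopologicalSpace H]
  {I : ModelWithCorners ℝ E H} {N : Type*} [TopologicalSpace N] [ChartedSpace H N]

theorem extChartAt_symplectization (p : N) :
    extChartAt (𝓘(ℝ, ℝ).prod I) ((0 : ℝ), p) = (PartialEquiv.refl ℝ).prod (extChartAt I p) := by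
  rw [extChartAt_prod, extChartAt_model_space_eq_id]

theorem extChartAt_symplectization_apply (p : N) (q : ℝ × N) :
    extChartAt (𝓘(ℝ, ℝ).prod I) ((0 : ℝ), p) q = (q.1, extChartAt I p q.2) := by
  rw [extChartAt_symplectization]
  rfl

theorem extChartAt_symplectization_symm_apply (p : N) (z : ℝ × E) :
    (extChartAt (𝓘(ℝ, ℝ).prod I) ((0 : ℝ), p)).symm z = (z.1, (extChartAt I p).symm z.2) := by
  rw [extChartAt_symplectization]
  rfl

theorem extChartAt_symplectization_target (p : N) :
    (extChartAt (𝓘(ℝ, ℝ).prod I) ((0 : ℝ), p)).target = univ ×ˢ (extChartAt I p).target := by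
  rw [extChartAt_symplectization]
  rfl

theorem isChartSupport_univ_prod [T2Space N] {p : N} {K : Set E} (hK : IsCompact K)
    (hKt : K ⊆ (extChartAt I p).target) :
    IsChartSupport (𝓘(ℝ, ℝ).prod I) ((0 : ℝ), p) (univ ×ˢ K) where
  subset_target := by
    rw [extChartAt_symplectization_target]
    exact prod_mono_right hKt
  isClosed := by
    have h : (extChartAt (𝓘(ℝ, ℝ).prod I) ((0 : ℝ), p)).symm '' (univ ×ˢ K) =
        univ ×ˢ ((extChartAt I p).symm '' K) := by
      ext ⟨s, y⟩
      simp only [mem_image, mem_prod, mem_univ, true_and, extChartAt_symplectization_symm_apply]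
      constructor
      · rintro ⟨z, hz, hzy⟩
        exact ⟨z.2, hz, congrArg Prod.snd hzy⟩
      · rintro ⟨x, hx, rfl⟩
        exact ⟨(s, x), hx, rfl⟩
    rw [h]
    exact isClosed_univ.prod
      (hK.image_of_continuousOn ((continuousOn_extChartAt_symm p).mono hKt)).isClosed

variable [I.Boundaryless] [IsManifold I ∞ N]

theorem oneFormInChart_symplectizationPrimitive (α : Π x : N, TangentSpace I x →L[ℝ] ℝ) {p : N}
    {z : ℝ × E} (hz : z.2 ∈ (extChartAt I p).target) :
    oneFormInChart (𝓘(ℝ, ℝ).prod I) (symplectizationPrimitive I α) ((0 : ℝ), p) z =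
      expLift (oneFormInChart I α p) z := by
  set e' := extChartAt (𝓘(ℝ, ℝ).prod I) ((0 : ℝ), p) with he'
  have hz' : z ∈ e'.target := by
    rw [extChartAt_symplectization_target]
    exact ⟨mem_univ _, hz⟩
  have h1 : MDifferentiableAt 𝓘(ℝ, ℝ × E) (𝓘(ℝ, ℝ).prod I) e'.symm z :=
    ((contMDiffOn_extChartAt_symm (I := 𝓘(ℝ, ℝ).prod I) (n := ∞) ((0 : ℝ), p)).contMDiffAt
      ((isOpen_extChartAt_target _).mem_nhds hz')).mdifferentiableAt (by simp)
  have h2 : MDifferentiableAt 𝓘(ℝ, E) I (extChartAt I p).symm z.2 :=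
    ((contMDiffOn_extChartAt_symm (I := I) (n := ∞) p).contMDiffAt
      ((isOpen_extChartAt_target _).mem_nhds hz)).mdifferentiableAt (by simp)
  have h3 := mfderiv_comp z (mdifferentiableAt_snd (I := 𝓘(ℝ, ℝ)) (I' := I)) h1
  have h4 : MDifferentiableAt 𝓘(ℝ, ℝ × E) 𝓘(ℝ, E) (Prod.snd : ℝ × E → E) z :=
    differentiableAt_snd.mdifferentiableAt
  have h5 := mfderiv_comp z h2 h4
  have h6 : (Prod.snd ∘ e'.symm : ℝ × E → N) = (extChartAt I p).symm ∘ Prod.snd := by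
    funext z
    exact congrArg Prod.snd (extChartAt_symplectization_symm_apply p z)
  rw [h6, h5] at h3
  have hsymm : e'.symm z = (z.1, (extChartAt I p).symm z.2) :=
    extChartAt_symplectization_symm_apply p z
  have h7 : ∀ q : ℝ × N, q = (z.1, (extChartAt I p).symm z.2) →
      Real.exp q.1 • (α q.2 : E →L[ℝ] ℝ) =
        Real.exp z.1 • (α ((extChartAt I p).symm z.2) : E →L[ℝ] ℝ) := by
    rintro _ rfl
    rfl
  refine ContinuousLinearMap.ext fun v : ℝ × E ↦ ?_
  have h8 : (mfderiv (𝓘(ℝ, ℝ).prod I) I Prod.snd (e'.symm z) : ℝ × E →L[ℝ] E)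
      ((mfderiv 𝓘(ℝ, ℝ × E) (𝓘(ℝ, ℝ).prod I) e'.symm z : ℝ × E →L[ℝ] ℝ × E) v) =
      (mfderiv 𝓘(ℝ, E) I (extChartAt I p).symm z.2 : E →L[ℝ] E) v.2 := by
    refine (congrArg (fun L : ℝ × E →L[ℝ] E ↦ L v) h3.symm).trans ?_
    rw [mfderiv_eq_fderiv, fderiv_snd]
    rfl
  change (Real.exp (e'.symm z).1 • (α (e'.symm z).2 : E →L[ℝ] ℝ))
    ((mfderiv (𝓘(ℝ, ℝ).prod I) I Prod.snd (e'.symm z) : ℝ × E →L[ℝ] E)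
      ((mfderiv 𝓘(ℝ, ℝ × E) (𝓘(ℝ, ℝ).prod I) e'.symm z : ℝ × E →L[ℝ] ℝ × E) v)) = _
  rw [h7 _ hsymm, h8]
  rfl

/-- A smooth 1-form, read in a chart and cut off, extends to a smooth 1-form on the whole model
space. -/
theorem IsSmoothOneForm.exists_extension_oneFormInChart [FiniteDimensional ℝ E]
    {α : Π x : N, TangentSpace I x →L[ℝ] ℝ} (hα : IsSmoothOneForm I α) (p : N) :
    ∃ A : E → E →L[ℝ] ℝ, ContDiff ℝ ∞ A ∧ ∃ W ∈ 𝓝 (extChartAt I p p),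
      W ⊆ (extChartAt I p).target ∧ ∀ z ∈ W, oneFormInChart I α p =ᶠ[𝓝 z] A := by
  obtain ⟨ρ, hρ, hball⟩ := Metric.nhds_basis_closedBall.mem_iff.1
    (extChartAt_target_mem_nhds (I := I) p)
  let b : ContDiffBump (extChartAt I p p) := ⟨ρ / 2, ρ, by positivity, by linarith⟩
  refine ⟨fun x ↦ b x • oneFormInChart I α p x, ?_, Metric.ball _ (ρ / 2),
    Metric.ball_mem_nhds _ (by positivity), fun z hz ↦ hball ?_, fun z hz ↦ ?_⟩
  · rw [contDiff_iff_contDiffAt]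
    intro x
    by_cases hx : x ∈ (extChartAt I p).target
    · exact b.contDiff.contDiffAt.smul
        ((hα.contDiffOn_oneFormInChart p).contDiffAt ((isOpen_extChartAt_target p).mem_nhds hx))
    · refine (contDiffAt_const (c := (0 : E →L[ℝ] ℝ))).congr_of_eventuallyEq ?_
      have hx' : x ∉ tsupport b := fun h ↦ hx (hball (by rwa [b.tsupport_eq] at h))
      filter_upwards [(isClosed_tsupport b).isOpen_compl.mem_nhds hx'] with y hy
      rw [image_eq_zero_of_notMem_tsupport hy, zero_smul]
  · exact Metric.ball_subset_closedBall.trans (Metric.closedBall_subset_closedBall (by linarith)) hz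
  · filter_upwards [Metric.isOpen_ball.mem_nhds hz] with y hy
    rw [b.one_of_mem_closedBall (Metric.ball_subset_closedBall hy), one_smul]

end Symplectization

/-! ### Conjugation towards infinity -/

section Conjugation

/-- Sequences of functions on the symplectization that decay like `e^{s - nc}` converge to zero
uniformly on compact sets. -/
theorem tendsto_zero_of_exp_decay {N : Type*} [TopologicalSpace N] {c C : ℝ} (hc : 0 < c)
    (h : ℕ → C(unitInterval × (ℝ × N), ℝ))
    (hh : ∀ n p, |h n p| ≤ C * Real.exp (p.2.1 - n * c)) : Tendsto h atTop (𝓝 0) := by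
  rw [ContinuousMap.tendsto_iff_forall_isCompact_tendstoUniformlyOn]
  intro K hK
  rcases K.eq_empty_or_nonempty with rfl | ⟨p₀, hp₀⟩
  · exact tendstoUniformlyOn_empty
  have hC : 0 ≤ C := by
    have h1 := (abs_nonneg _).trans (hh 0 p₀)
    exact nonneg_of_mul_nonneg_left h1 (Real.exp_pos _)
  obtain ⟨B, hB⟩ := (hK.image (f := fun p : unitInterval × (ℝ × N) ↦ p.2.1)
    (by fun_prop)).bddAbove
  have hlim : Tendsto (fun n : ℕ ↦ C * Real.exp (B - n * c)) atTop (𝓝 0) := by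
    rw [← mul_zero C]
    refine (Real.tendsto_exp_atBot.comp ?_).const_mul C
    refine tendsto_atBot_add_const_left _ B ?_ |>.congr fun n ↦ (sub_eq_add_neg _ _).symm
    exact tendsto_neg_atTop_atBot.comp (tendsto_natCast_atTop_atTop.atTop_mul_const hc)
  rw [Metric.tendstoUniformlyOn_iff]
  intro ε hε
  filter_upwards [hlim.eventually (gt_mem_nhds hε)] with n hn p hp
  rw [dist_comm, ContinuousMap.zero_apply, dist_zero_right, Real.norm_eq_abs]
  refine (hh n p).trans_lt (lt_of_le_of_lt ?_ hn)
  have : p.2.1 ≤ B := hB (mem_image_of_mem _ hp)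
  gcongr

/-- Conjugating a Hamiltonian flow by `χ` replaces the Hamiltonian `h` by `h ∘ χ⁻¹`. If `χ` pushes
`ℝ × P` up by `c`, then `h` supported over `P` with bound `e^{s - a}` acquires the bound
`e^{s - a - c}`. -/
theorem exp_decay_comp_symm {E : Type*} [TopologicalSpace E] {P : Set E} {c C a : ℝ}
    {χ : (ℝ × E) ≃ₜ (ℝ × E)} {h : ℝ × E → ℝ}
    (hχ : ∀ s, ∀ x ∈ P, (χ (s, x)).2 ∈ P ∧ s + c ≤ (χ (s, x)).1) (hC : 0 ≤ C)
    (hP : ∀ z, h z ≠ 0 → z.2 ∈ P) (hh : ∀ z, |h z| ≤ C * Real.exp (z.1 - a)) :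
    (∀ z, (h ∘ χ.symm) z ≠ 0 → z.2 ∈ P) ∧
      ∀ z, |(h ∘ χ.symm) z| ≤ C * Real.exp (z.1 - (a + c)) := by
  have key : ∀ z, h (χ.symm z) ≠ 0 → z.2 ∈ P ∧ (χ.symm z).1 + c ≤ z.1 := fun z hz ↦ by
    simpa using hχ (χ.symm z).1 (χ.symm z).2 (hP _ hz)
  refine ⟨fun z hz ↦ (key z hz).1, fun z ↦ ?_⟩
  by_cases hz : h (χ.symm z) = 0
  · rw [Function.comp_apply, hz, abs_zero]
    positivity
  · refine (hh _).trans (mul_le_mul_of_nonneg_left (Real.exp_le_exp.2 ?_) hC)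
    have := (key z hz).2
    linarith

theorem chartDiffeo_conj_eq {E : Type*} [NormedAddCommGroup E] [NormedSpace ℝ E] {H : Type*}
    [TopologicalSpace H] {I : ModelWithCorners ℝ E H} [I.Boundaryless] {M : Type*}
    [TopologicalSpace M] [ChartedSpace H M] [IsManifold I ∞ M] {x₀ : M} {S : Set E}
    (hS : IsChartSupport I x₀ S) {χ ψ : E ≃ₜ E} (hχ : IsSupportedDiffeo S χ)
    (hψ : IsSupportedDiffeo S ψ) (h : IsSupportedDiffeo S ((χ.symm.trans ψ).trans χ)) :
    (chartDiffeo hS hχ).trans (chartDiffeo hS h) =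
      (chartDiffeo hS hψ).trans (chartDiffeo hS hχ) := by
  refine Diffeomorph.ext fun q ↦ ?_
  change chartExtend I x₀ _ (chartExtend I x₀ χ q) = chartExtend I x₀ χ (chartExtend I x₀ ψ q)
  rw [hS.chartExtend_comp hχ, hS.chartExtend_comp hψ]
  congr 1
  ext x
  simp

end Conjugation

theorem theorem5 (m : ℕ) (hm : 3 ≤ m)
    (N : Type*) [TopologicalSpace N] [T2Space N] [SecondCountableTopology N]
    [ChartedSpace (EuclideanSpace ℝ (Fin m)) N] [IsManifold (𝓡 m) ∞ N]
    (α : Π x : N, TangentSpace (𝓡 m) x →L[ℝ] ℝ) (hα : IsContactForm (𝓡 m) α)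
    (hγ : HasClosedCharacteristic (𝓡 m) α) :
    ¬ ∃ d : ((ℝ × N) ≃ₘ⟮𝓘(ℝ, ℝ).prod (𝓡 m), 𝓘(ℝ, ℝ).prod (𝓡 m)⟯ (ℝ × N)) →
        ((ℝ × N) ≃ₘ⟮𝓘(ℝ, ℝ).prod (𝓡 m), 𝓘(ℝ, ℝ).prod (𝓡 m)⟯ (ℝ × N)) → ℝ,
      IsBiinvariantMetric (𝓘(ℝ, ℝ).prod (𝓡 m))
        (HamDiffeo (𝓘(ℝ, ℝ).prod (𝓡 m)) (symplectizationForm (𝓡 m) α)) d ∧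
      IsCMinusOne (𝓘(ℝ, ℝ).prod (𝓡 m)) (symplectizationForm (𝓡 m) α) d := by
  rintro ⟨d, hd, D, hD, hDcont⟩
  obtain ⟨R, hR, γ, -⟩ := hγ
  set p : N := γ 0 with hp
  set e := extChartAt (𝓡 m) p with he
  obtain ⟨A, hA, W, hW, hWt, hAW⟩ := hα.smooth.exists_extension_oneFormInChart p
  have hAp := hAW _ (mem_of_mem_nhds hW)
  have hA0 : ∀ u, A (e p) u = (α p : EuclideanSpace ℝ (Fin m) →L[ℝ] ℝ) u := fun u ↦ by
    rw [← hAp.eq_of_nhds, oneFormInChart_self]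
  have hdA : ∀ u v, extDerivOneForm A (e p) u v = oneFormExtDeriv (𝓡 m) α p u v := fun u v ↦ by
    simp only [extDerivOneForm]
    rw [← hAp.fderiv_eq]
    rfl
  have hcontact : IsContactAt A (e p) (R p) :=
    ⟨fun u hu h ↦ hα.nondegenerate p u ((hA0 u).symm.trans hu) fun v hv ↦
        (hdA u v).symm.trans (h v ((hA0 v).trans hv)),
      (hA0 _).trans (hR p).2, fun v ↦ (hdA _ v).trans ((hR p).1 v)⟩
  -- `χ` pushes `ℝ × P` up; `φ` is a nontrivial flow supported over `P`.
  obtain ⟨K, hKW, hK, P, hP, hPK, c, hc, _, _, φ₁, -, hφ₁, hχ, hpush⟩ :=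
    hcontact.exists_pushing_hamiltonian hA hW
  obtain ⟨K₂, hKP, -, P₂, hP₂, -, c₂, hc₂, g, C, φ, hgC, hφ, -, hpush₂⟩ :=
    hcontact.exists_pushing_hamiltonian hA hP
  have hgP : ∀ z : ℝ × EuclideanSpace ℝ (Fin m), Real.exp z.1 * g z.2 ≠ 0 → z.2 ∈ P :=
    fun z hz ↦ by
      by_contra hn
      exact hz (hφ.ham_eq_zero z fun h ↦ hn (hKP h.2))
  replace hφ := hφ.mono (prod_mono_right (s := univ) (hKP.trans hPK))
  set S : Set (ℝ × EuclideanSpace ℝ (Fin m)) := univ ×ˢ K with hSdef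
  have hS : IsChartSupport (𝓘(ℝ, ℝ).prod (𝓡 m)) ((0 : ℝ), p) S :=
    isChartSupport_univ_prod hK (hKW.trans hWt)
  have hβ : Differentiable ℝ (expLift A) := fun z ↦
    (hasFDerivAt_expLift (hA.differentiable (by simp) _)).differentiableAt
  have hΘ : ∀ z ∈ S, oneFormInChart (𝓘(ℝ, ℝ).prod (𝓡 m)) (symplectizationPrimitive (𝓡 m) α)
      ((0 : ℝ), p) =ᶠ[𝓝 z] expLift A := by
    intro z hz
    have h1 := hAW z.2 (hKW hz.2)
    have h2 := (extChartAt_target_mem_nhds' (I := 𝓡 m) (hWt (hKW hz.2)))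
    filter_upwards [continuousAt_snd.eventually h1, continuousAt_snd.eventually h2] with y hy hy'
    rw [oneFormInChart_symplectizationPrimitive α hy', expLift, hy, expLift]
  have hgen : ∀ {h : ℝ × EuclideanSpace ℝ (Fin m) → ℝ} {φ : ℝ → _} (hφ : IsLocalHamiltonianFlow
      (expLift A) S h φ), Generates (𝓘(ℝ, ℝ).prod (𝓡 m)) (symplectizationForm (𝓡 m) α)
        (chartPath hS hφ.contDiff_ham hφ.ham_eq_zero) (chartDiffeo hS (hφ.supported 1)) :=
    fun hφ ↦ hφ.generates hS hβ hΘ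
  have hrefl : Generates (𝓘(ℝ, ℝ).prod (𝓡 m)) (symplectizationForm (𝓡 m) α) 0
      (Diffeomorph.refl (𝓘(ℝ, ℝ).prod (𝓡 m)) (ℝ × N) ∞) := by
    have h1 : IsLocalHamiltonianFlow (expLift A) S (fun _ ↦ 0) (fun _ ↦ Homeomorph.refl _) :=
      ⟨contDiff_const, fun _ _ ↦ rfl, fun _ ↦ ⟨contDiff_id, contDiff_id, fun _ _ ↦ rfl⟩,
        fun _ ↦ rfl, fun t _ x ↦ ⟨0, fun w ↦ by simp [extDerivOneForm],
          hasDerivWithinAt_const _ _ _⟩⟩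
    have h2 := hgen h1
    have h3 : chartPath hS h1.contDiff_ham h1.ham_eq_zero = 0 := by
      ext q
      exact ite_self (0 : ℝ)
    have h4 : chartDiffeo hS (h1.supported 1) =
        Diffeomorph.refl (𝓘(ℝ, ℝ).prod (𝓡 m)) (ℝ × N) ∞ :=
      Diffeomorph.ext fun q ↦ chartExtend_id q
    rwa [h3, h4] at h2
  have hC : 0 ≤ C := (abs_nonneg _).trans (hgC (e p))
  -- The conjugates of `φ` by the powers of `χ`.
  have hconj : ∀ n : ℕ, ∃ (h : ℝ × EuclideanSpace ℝ (Fin m) → ℝ) (ψ : ℝ → _)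
      (hψ : IsLocalHamiltonianFlow (expLift A) S h ψ), (∀ z, h z ≠ 0 → z.2 ∈ P) ∧
      (∀ z, |h z| ≤ C * Real.exp (z.1 - n * c)) ∧
      d (chartDiffeo hS (hψ.supported 1)) (Diffeomorph.refl (𝓘(ℝ, ℝ).prod (𝓡 m)) (ℝ × N) ∞) =
        d (chartDiffeo hS (hφ.supported 1)) (Diffeomorph.refl (𝓘(ℝ, ℝ).prod (𝓡 m)) (ℝ × N) ∞) := by
    intro n
    induction n with
    | zero =>
      refine ⟨_, φ, hφ, hgP, fun z ↦ ?_, rfl⟩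
      rw [abs_mul, abs_of_pos (Real.exp_pos _), mul_comm]
      simpa using mul_le_mul_of_nonneg_right (hgC z.2) (Real.exp_pos z.1).le
    | succ n ih =>
      obtain ⟨h, ψ, hψ, h1, h2, h3⟩ := ih
      have h4 := exp_decay_comp_symm hpush hC h1 h2
      refine ⟨_, _, hψ.conj hβ hχ, h4.1, fun z ↦ ?_, ?_⟩
      · have h5 : ((n + 1 : ℕ) : ℝ) * c = n * c + c := by
          push_cast
          ring
        rw [h5]
        exact h4.2 z
      · have h5 := hgen (hψ.conj hβ hχ)
        have h6 := hgen hφ₁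
        have h7 := hgen hψ
        rw [← hd.right_invariant _ ⟨_, h5⟩ _ ⟨_, hrefl⟩ _ ⟨_, h6⟩,
          chartDiffeo_conj_eq hS (hφ₁.supported 1) (hψ.supported 1), ← h3,
          ← hd.left_invariant _ ⟨_, h7⟩ _ ⟨_, hrefl⟩ _ ⟨_, h6⟩]
        rfl
  choose h ψ hψ _ hdecay hdist using hconj
  have hlim := tendsto_zero_of_exp_decay hc
    (fun n ↦ chartPath hS (hψ n).contDiff_ham (hψ n).ham_eq_zero) (C := C) fun n q ↦ by
      change |chartExtendZero (𝓘(ℝ, ℝ).prod (𝓡 m)) ((0 : ℝ), p) (h n) q.2| ≤ _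
      by_cases hq : q.2 ∈ (extChartAt (𝓘(ℝ, ℝ).prod (𝓡 m)) ((0 : ℝ), p)).source
      · rw [chartExtendZero_of_mem hq]
        refine (hdecay n _).trans ?_
        rw [extChartAt_symplectization_apply]
      · rw [chartExtendZero, if_neg hq, abs_zero]
        positivity
  have hmem : ∀ n, chartPath hS (hψ n).contDiff_ham (hψ n).ham_eq_zero ∈
      Ham (𝓘(ℝ, ℝ).prod (𝓡 m)) (symplectizationForm (𝓡 m) α) := fun n ↦ ⟨_, hgen (hψ n)⟩
  have hmem0 : (0 : C(unitInterval × (ℝ × N), ℝ)) ∈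
      Ham (𝓘(ℝ, ℝ).prod (𝓡 m)) (symplectizationForm (𝓡 m) α) := ⟨_, hrefl⟩
  have hD0 : D (0, 0) = 0 := by
    rw [hD _ _ _ _ hrefl hrefl, hd.eq_zero_iff _ ⟨_, hrefl⟩ _ ⟨_, hrefl⟩]
  have hDlim : Tendsto (fun n ↦ D (chartPath hS (hψ n).contDiff_ham (hψ n).ham_eq_zero, 0)) atTop
      (𝓝 0) := by
    have h1 := hDcont (0, 0) ⟨hmem0, hmem0⟩
    rw [ContinuousWithinAt, hD0] at h1
    refine h1.comp (tendsto_nhdsWithin_iff.2 ⟨hlim.prodMk_nhds tendsto_const_nhds,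
      Eventually.of_forall fun n ↦ ⟨hmem n, hmem0⟩⟩)
  have hDconst : ∀ n, D (chartPath hS (hψ n).contDiff_ham (hψ n).ham_eq_zero, 0) =
      d (chartDiffeo hS (hφ.supported 1))
        
        
        
        
        (Diffeomorph.refl (𝓘(ℝ, ℝ).prod (𝓡 m)) (ℝ × N) ∞) := fun n ↦ by
    rw [hD _ _ _ _ (hgen (hψ n)) hrefl, hdist n]
  simp only [hDconst] at hDlim
  have hzero := tendsto_nhds_unique tendsto_const_nhds hDlim
  rw [hd.eq_zero_iff _ ⟨_, hgen hφ⟩ _ ⟨_, hrefl⟩] at hzero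
  -- The point over `p` at height `0` is moved up by `φ`, which is therefore not the identity.
  have hfix := congrArg (fun f : (ℝ × N) ≃ₘ⟮𝓘(ℝ, ℝ).prod (𝓡 m), 𝓘(ℝ, ℝ).prod (𝓡 m)⟯ (ℝ × N) ↦
    (f (0, p)).1) hzero
  have hmove := (hpush₂ 0 (e p) (mem_of_mem_nhds hP₂)).2
  have h1 : (chartDiffeo hS (hφ.supported 1) (0, p)).1 = (φ 1 (0, e p)).1 := by
    rw [chartDiffeo_apply, chartExtend_of_mem (mem_extChartAt_source _),
      extChartAt_symplectization_symm_apply, extChartAt_symplectization_apply]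
  have h2 : (φ 1 (0, e p)).1 = 0 := h1.symm.trans hfix
  linarith
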